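/- A fusion category is a $\mathbb{C}$-linear, abelian, semisimple, rigid monoidal category with finite-dimensional Hom-spaces, finitely many isomorphism classes of simple objects and simple unit object; a premodular category is a fusion category $\mathcal{C}$ with a braiding and a spherical structure $j$, i.e. an isomorphism of monoidal functors $j:\mathrm{id}_{\mathcal{C}}\to(-)^{**}$ with $\dim(V)=\dim(V^*)$ for every simple object $V$, where $\dim$ is the pivotal dimension (the pivotal trace of the identity) defined by $j$. Let $\mathcal{O}(\mathcal{C})$ be the set of isomorphism classes of simple objects, let $\theta=u^{-1}j$ be the twist, where $u:\mathrm{id}_{\mathcal{C}}\to(-)^{**}$ is the Drinfeld isomorphism determined by the braiding, and for simple $X$ write $\theta_X$ also for the scalar by which $\theta$ acts on $X$. For $n\in\mathbb{Z}$ define the $n$-th Gauss sum $$\tau_n(\mathcal{C})=\sum_{X\in\mathcal{O}(\mathcal{C})}\theta_X^{\,n}\dim(X)^2,$$ and, if $\tau_n(\mathcal{C})\neq 0$, the $n$-th anomaly and the $n$-th central charge $$\alpha_n(\mathcal{C})=\frac{\tau_n(\mathcal{C})}{\tau_{-n}(\mathcal{C})},\qquad \xi_n(\mathcal{C})=\frac{\tau_n(\mathcal{C})}{|\tau_n(\mathcal{C})|}.$$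 **Proposition.** Let $\mathcal{C}$ be a premodular category. Then $$\tau_1(\mathcal{C})\,\tau_{-2}(\mathcal{C})\in\mathbb{R}\qquad\text{and}\qquad \tau_1(\mathcal{C})\,\tau_{-2}(\mathcal{C})=\tau_{-1}(\mathcal{C})\,\tau_2(\mathcal{C}).$$ If $\tau_1(\mathcal{C})\,\tau_{-2}(\mathcal{C})\neq 0$, then $\tau_{1}(\mathcal{C})$, $\tau_{-1}(\mathcal{C})$, $\tau_{2}(\mathcal{C})$ and $\tau_{-2}(\mathcal{C})$ are all nonzero, $\alpha_1(\mathcal{C})=\alpha_2(\mathcal{C})$, and $\xi_1(\mathcal{C})=\xi_2(\mathcal{C})$ or $\xi_1(\mathcal{C})=-\xi_2(\mathcal{C})$. -/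

import Mathlib

open CategoryTheory MonoidalCategory Limits

universe v u

noncomputable section

namespace Premodular

/-! ### Simple objects and fusion categories -/

/-- Two simple objects are equivalent when they are isomorphic. -/
def simpleSetoid (C : Type u) [Category.{v} C] [Abelian C] : Setoid {X : C // Simple X} where
  r X Y := Nonempty (X.1 ≅ Y.1)
  iseqv := ⟨fun X => ⟨Iso.refl X.1⟩, fun ⟨e⟩ => ⟨e.symm⟩, fun ⟨e⟩ ⟨f⟩ => ⟨e.trans f⟩⟩

/-- The set `𝒪(C)` of isomorphism classes of simple objects. -/
def SimpleClass (C : Type u) [Category.{v} C] [Abelian C] : Type u :=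
  Quotient (simpleSetoid C)

/-- A representative of an isomorphism class of simple objects. -/
def SimpleClass.obj {C : Type u} [Category.{v} C] [Abelian C] (x : SimpleClass C) : C :=
  (Quotient.out x).1

instance SimpleClass.simple_obj {C : Type u} [Category.{v} C] [Abelian C] (x : SimpleClass C) : Simple x.obj :=
  (Quotient.out x).2

attribute [local instance] Abelian.hasFiniteBiproducts

/-- A `ℂ`-linear abelian rigid monoidal category (with `ℂ`-bilinear tensor product of morphisms)
is a fusion category if it is semisimple, has finite-dimensional Hom-spaces, has finitely many
isomorphism classes of simple objects, and its unit object is simple. -/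
class IsFusion (C : Type u) [Category.{v} C] [Abelian C] [Linear ℂ C] [MonoidalCategory C]
    [MonoidalPreadditive C] [MonoidalLinear ℂ C] [RigidCategory C] : Prop where
  finiteDimensional_hom (X Y : C) : FiniteDimensional ℂ (X ⟶ Y)
  semisimple (X : C) :
    ∃ (n : ℕ) (S : Fin n → C), (∀ i, Simple (S i)) ∧ Nonempty (X ≅ ⨁ S)
  finite_simpleClass : Finite (SimpleClass C)
  simple_unit : Simple (𝟙_ C)

attribute [instance] IsFusion.finiteDimensional_hom IsFusion.simple_unit

/-! ### Duals and pivotal structures -/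

section Pivotal

variable {C : Type u} [Category.{v} C] [MonoidalCategory C] [RightRigidCategory C]

/-- The (chosen) dual `X*` of an object, which comes with `X* ⊗ X ⟶ 𝟙` and `𝟙 ⟶ X ⊗ X*`. -/
abbrev dual (X : C) : C := (RightRigidCategory.rightDual X).rightDual

/-- The evaluation `X* ⊗ X ⟶ 𝟙`. -/
abbrev ev (X : C) : dual X ⊗ X ⟶ 𝟙_ C :=
  @ExactPairing.evaluation C _ _ X (dual X) (RightRigidCategory.rightDual X).exact

/-- The coevaluation `𝟙 ⟶ X ⊗ X*`. -/
abbrev coev (X : C) : 𝟙_ C ⟶ X ⊗ dual X :=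
  @ExactPairing.coevaluation C _ _ X (dual X) (RightRigidCategory.rightDual X).exact

/-- The dual `f* : Y* ⟶ X*` of a morphism `f : X ⟶ Y`. -/
abbrev dualMap {X Y : C} (f : X ⟶ Y) : dual Y ⟶ dual X :=
  @rightAdjointMate C _ _ X Y (RightRigidCategory.rightDual X) (RightRigidCategory.rightDual Y) f

theorem dualMap_id (X : C) : dualMap (𝟙 X) = 𝟙 (dual X) :=
  @rightAdjointMate_id C _ _ X (RightRigidCategory.rightDual X)

theorem dualMap_comp {X Y Z : C} (f : X ⟶ Y) (g : Y ⟶ Z) :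
    dualMap (f ≫ g) = dualMap g ≫ dualMap f :=
  @comp_rightAdjointMate C _ _ X Y Z (RightRigidCategory.rightDual X)
    (RightRigidCategory.rightDual Y) (RightRigidCategory.rightDual Z) f g

/-- The isomorphism `A* ≅ B*` induced by an isomorphism `e : A ≅ B`. -/
def dualIso {A B : C} (e : A ≅ B) : dual A ≅ dual B where
  hom := dualMap e.inv
  inv := dualMap e.hom
  hom_inv_id := by rw [← dualMap_comp, e.hom_inv_id, dualMap_id]
  inv_hom_id := by rw [← dualMap_comp, e.inv_hom_id, dualMap_id]

variable (C) in
/-- The double dual functor `X ↦ X**`. -/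
def doubleDual : C ⥤ C where
  obj X := dual (dual X)
  map f := dualMap (dualMap f)
  map_id X := by rw [dualMap_id, dualMap_id]
  map_comp f g := by rw [dualMap_comp, dualMap_comp]

/-- The canonical isomorphism `(X ⊗ Y)* ≅ Y* ⊗ X*` between two duals of `X ⊗ Y`. -/
def dualTensorIso (X Y : C) : dual (X ⊗ Y) ≅ dual Y ⊗ dual X :=
  rightDualIso (RightRigidCategory.rightDual (X ⊗ Y)).exact
    (@ExactPairing.tensor C _ _ X Y (dual X) (dual Y) (RightRigidCategory.rightDual X).exact
      (RightRigidCategory.rightDual Y).exact)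

/-- The canonical isomorphism `𝟙* ≅ 𝟙` between two duals of `𝟙`. -/
def dualUnitIso : dual (𝟙_ C) ≅ 𝟙_ C :=
  rightDualIso (RightRigidCategory.rightDual (𝟙_ C)).exact exactPairingUnit

/-- The canonical isomorphism `(X ⊗ Y)** ≅ (Y* ⊗ X*)* ≅ X** ⊗ Y**`, the tensor structure of the
double dual functor. -/
def doubleDualTensorIso (X Y : C) :
    dual (dual (X ⊗ Y)) ≅ dual (dual X) ⊗ dual (dual Y) :=
  dualIso (dualTensorIso X Y) ≪≫ dualTensorIso (dual Y) (dual X)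

/-- The canonical isomorphism `𝟙** ≅ 𝟙* ≅ 𝟙`, the unit structure of the double dual functor. -/
def doubleDualUnitIso : dual (dual (𝟙_ C)) ≅ 𝟙_ C :=
  dualIso dualUnitIso ≪≫ dualUnitIso

variable (C) in
/-- A pivotal structure: an isomorphism of monoidal functors from the identity functor to the
double dual functor. -/
structure PivotalStructure where
  /-- The underlying natural isomorphism. -/
  iso : 𝟭 C ≅ doubleDual C
  tensor (X Y : C) :
    iso.hom.app (X ⊗ Y) ≫ (doubleDualTensorIso X Y).hom = iso.hom.app X ⊗ₘ iso.hom.app Y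
  unit : iso.hom.app (𝟙_ C) ≫ doubleDualUnitIso.hom = 𝟙 (𝟙_ C)

/-- The component `j_X : X ≅ X**` of a pivotal structure. -/
def PivotalStructure.appIso (j : PivotalStructure C) (X : C) : X ≅ dual (dual X) :=
  j.iso.app X

/-- The left pivotal trace of an endomorphism `f` of `V`, as an endomorphism of the unit object:
`𝟙 ⟶ V* ⊗ V** ⟶ V* ⊗ V ⟶ V* ⊗ V ⟶ 𝟙`. -/
def PivotalStructure.trace (j : PivotalStructure C) {V : C} (f : V ⟶ V) : 𝟙_ C ⟶ 𝟙_ C :=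
  coev (dual V) ≫ dual V ◁ (j.appIso V).inv ≫ dual V ◁ f ≫ ev V

end Pivotal

/-! ### The Drinfeld isomorphism and the twist -/

section Braided

variable {C : Type u} [Category.{v} C] [MonoidalCategory C] [RightRigidCategory C]
  [BraidedCategory C]

/-- The Drinfeld isomorphism `u : X ≅ X**` of a braided rigid category. It compares the two duals
`X` and `X**` of `X*`, where `X` is a dual of `X*` by means of the braiding; see
`drinfeldIso_hom` for the usual formula. -/
def drinfeldIso (X : C) : X ≅ dual (dual X) :=
  rightDualIso
    (@BraidedCategory.exactPairing_swap C _ _ _ X (dual X) (RightRigidCategory.rightDual X).exact)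
    (RightRigidCategory.rightDual (dual X)).exact

/-- The Drinfeld isomorphism is the composite
`X ⟶ X ⊗ (X* ⊗ X**) ⟶ (X ⊗ X*) ⊗ X** ⟶ (X* ⊗ X) ⊗ X** ⟶ X**`
of coevaluation, associativity, braiding, and evaluation. -/
theorem drinfeldIso_hom (X : C) :
    (drinfeldIso X).hom =
      (ρ_ X).inv ≫ X ◁ coev (dual X) ≫ (α_ X (dual X) (dual (dual X))).inv ≫
        (β_ X (dual X)).hom ▷ dual (dual X) ≫ ev X ▷ dual (dual X) ≫
          (λ_ (dual (dual X))).hom := by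
  have h : (drinfeldIso X).hom =
      (ρ_ X).inv ≫ X ◁ coev (dual X) ≫ X ◁ (𝟙 (dual X)) ▷ dual (dual X) ≫
        (α_ X (dual X) (dual (dual X))).inv ≫
          ((β_ X (dual X)).hom ≫ ev X) ▷ dual (dual X) ≫ (λ_ (dual (dual X))).hom := rfl
  rw [h]
  simp

/-- The twist (ribbon isomorphism) `θ = u⁻¹ ∘ j` of a pivotal braided category. -/
def PivotalStructure.twist (j : PivotalStructure C) (X : C) : X ≅ X :=
  j.appIso X ≪≫ (drinfeldIso X).symm

end Braided

/-! ### Numerical invariants of premodular categories -/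

section Fusion

variable {C : Type u} [Category.{v} C] [Abelian C] [Linear ℂ C] [MonoidalCategory C]
  [MonoidalPreadditive C] [MonoidalLinear ℂ C] [RigidCategory C] [IsFusion C]

instance SimpleClass.fintype : Fintype (SimpleClass C) :=
  @Fintype.ofFinite _ IsFusion.finite_simpleClass

/-- The scalar by which an endomorphism of a simple object acts (it exists by Schur's lemma). -/
def scalar {X : C} [Simple X] (f : X ⟶ X) : ℂ :=
  (endomorphism_simple_eq_smul_id ℂ f).choose

theorem scalar_smul_id {X : C} [Simple X] (f : X ⟶ X) : scalar f • 𝟙 X = f :=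
  (endomorphism_simple_eq_smul_id ℂ f).choose_spec

theorem scalar_eq {X : C} [Simple X] {f : X ⟶ X} {c : ℂ} (h : f = c • 𝟙 X) : scalar f = c :=
  smul_left_injective ℂ (id_nonzero X) ((scalar_smul_id f).trans h)

/-- The (left) pivotal dimension of an object. -/
def PivotalStructure.dim (j : PivotalStructure C) (X : C) : ℂ :=
  scalar (j.trace (𝟙 X))

variable (C) in
/-- A spherical structure on a fusion category: a pivotal structure for which
`dim V = dim V*` for every simple object `V`. -/
structure SphericalStructure extends PivotalStructure C where
  spherical (V : C) [Simple V] :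
    toPivotalStructure.dim V = toPivotalStructure.dim (dual V)

variable [BraidedCategory C] (j : SphericalStructure C)

/-- The scalar `θ_X` by which the twist acts on a simple object `X`. -/
def SphericalStructure.θ (X : C) [Simple X] : ℂ :=
  scalar (j.twist X).hom

/-- The `n`-th Gauss sum `τ_n(C) = ∑ θ_X ^ n * dim(X) ^ 2`, the sum over the isomorphism classes of
simple objects. -/
def SphericalStructure.gaussSum (n : ℤ) : ℂ :=
  ∑ x : SimpleClass C, j.θ x.obj ^ n * j.dim x.obj ^ 2

/-- The `n`-th anomaly `α_n(C) = τ_n(C) / τ_{-n}(C)`, meaningful when `τ_n(C) ≠ 0`. -/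
def SphericalStructure.anomaly (n : ℤ) : ℂ :=
  j.gaussSum n / j.gaussSum (-n)

/-- The `n`-th (multiplicative) central charge `ξ_n(C) = τ_n(C) / |τ_n(C)|`, meaningful when
`τ_n(C) ≠ 0`. -/
def SphericalStructure.centralCharge (n : ℤ) : ℂ :=
  j.gaussSum n / (‖j.gaussSum n‖ : ℂ)

end Fusion

end Premodular

end

noncomputable section

namespace Premodular

/-! ### Comparison of two duals of one object -/

section Pairings

variable {C : Type u} [Category.{v} C] [MonoidalCategory C]

/-! Write `d` for the dimension, `N_{xy}^z = dim Hom(x ⊗ y, z)` and `S_{xy}` for the trace of the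
double braiding. Balancing (`twist_tensor`) gives `∑_z N_{xy}^z θ_z d_z = θ_x θ_y S_{xy}`, and
Frobenius reciprocity gives `∑_x N_{xy}^z d_x = d_y d_z`. Together they yield `τ_1 τ_{-2} = ∑_{x,y}
θ_x θ_y⁻¹ d_x d_y S_{xy}`. Conjugation inverts `θ`, fixes `d` and turns `S_{xy}` into `S_{x*y}`.
Since `θ` and `d` are invariant under duality and `S` is symmetric, reindexing by `x ↦ x*` and
exchanging `x` with `y` shows that the double sum is real. The rest follows from `τ_{-n} = conj
τ_n`.

Two facts support the conjugation rules. A loop labelled `X` around a simple `Y` defines a character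
of the fusion ring, and such characters send duals to conjugates (`character_dual`); the case `Y =
𝟙` makes `d` real. Moreover `|θ_X| = 1` (`norm_θ`), by a Vafa-type determinant argument that needs
only an extremal modulus and not the finite order of `θ`. -/

theorem rightDualIso_hom_evaluation {X Y₁ Y₂ : C} (p₁ : ExactPairing X Y₁)
    (p₂ : ExactPairing X Y₂) :
    (rightDualIso p₁ p₂).hom ▷ X ≫ p₂.evaluation = p₁.evaluation := by
  have := @rightAdjointMate_comp_evaluation C _ _ X X ⟨Y₂⟩ ⟨Y₁⟩ (𝟙 X)
  rw [whiskerLeft_id, Category.id_comp] at this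
  exact this

theorem coevaluation_rightDualIso_hom {X Y₁ Y₂ : C} (p₁ : ExactPairing X Y₁)
    (p₂ : ExactPairing X Y₂) :
    p₁.coevaluation ≫ X ◁ (rightDualIso p₁ p₂).hom = p₂.coevaluation := by
  have := @coevaluation_comp_rightAdjointMate C _ _ X X ⟨Y₂⟩ ⟨Y₁⟩ (𝟙 X)
  rw [id_whiskerRight, Category.comp_id] at this
  exact this

theorem coevaluation_whiskerLeft_injective {X Y Z : C} (p : ExactPairing X Y) {f g : Y ⟶ Z}
    (h : p.coevaluation ≫ X ◁ f = p.coevaluation ≫ X ◁ g) : f = g := by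
  have := congrArg (tensorLeftHomEquiv (𝟙_ C) X Y Z).symm h
  simpa using this

end Pairings

/-! ### The coevaluation `𝟙 ⟶ X* ⊗ X` of a pivotal category -/

section Pivotal

variable {C : Type u} [Category.{v} C] [MonoidalCategory C] [RightRigidCategory C]

theorem coev_dualMap {X Y : C} (f : X ⟶ Y) :
    coev Y ≫ Y ◁ dualMap f = coev X ≫ f ▷ dual X :=
  coevaluation_comp_rightAdjointMate f

theorem dualMap_ev {X Y : C} (f : X ⟶ Y) :
    dualMap f ▷ X ≫ ev X = dual Y ◁ f ≫ ev Y :=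
  rightAdjointMate_comp_evaluation f

theorem dualTensorIso_ev (X Y : C) :
    (dualTensorIso X Y).hom ▷ (X ⊗ Y) ≫ 𝟙 _ ⊗≫ dual Y ◁ (ev X ▷ Y) ⊗≫ ev Y = ev (X ⊗ Y) :=
  rightDualIso_hom_evaluation _ _

theorem coev_dualTensorIso (X Y : C) :
    coev (X ⊗ Y) ≫ (X ⊗ Y) ◁ (dualTensorIso X Y).hom =
      coev X ⊗≫ (X ◁ coev Y) ▷ dual X ⊗≫ 𝟙 _ :=
  coevaluation_rightDualIso_hom _ _

namespace PivotalStructure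

variable (j : PivotalStructure C)

/-- The coevaluation `𝟙 ⟶ X* ⊗ X` determined by a pivotal structure. -/
def pcoev (X : C) : 𝟙_ C ⟶ dual X ⊗ X :=
  coev (dual X) ≫ dual X ◁ (j.appIso X).inv

theorem pcoev_appIso (X : C) : j.pcoev X ≫ dual X ◁ (j.appIso X).hom = coev (dual X) := by
  simp [pcoev, ← whiskerLeft_comp]

theorem appIso_naturality {X Y : C} (f : X ⟶ Y) :
    f ≫ (j.appIso Y).hom = (j.appIso X).hom ≫ dualMap (dualMap f) :=
  j.iso.hom.naturality f

theorem appIso_inv_naturality {X Y : C} (f : X ⟶ Y) :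
    (j.appIso X).inv ≫ f = dualMap (dualMap f) ≫ (j.appIso Y).inv := by
  rw [Iso.inv_comp_eq, ← Category.assoc, Iso.eq_comp_inv, appIso_naturality]

theorem pcoev_naturality {X Y : C} (f : X ⟶ Y) :
    j.pcoev X ≫ dual X ◁ f = j.pcoev Y ≫ dualMap f ▷ Y := by
  rw [pcoev, pcoev, Category.assoc, ← whiskerLeft_comp, appIso_inv_naturality, whiskerLeft_comp,
    ← Category.assoc, coev_dualMap, Category.assoc, Category.assoc, whisker_exchange]

/-- Bending a leg by duality loses nothing. The identities for the twist are tested in this form,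
because the twist has a simple expression after `pcoev`. -/
theorem pcoev_whiskerLeft_injective {X Z : C} {f g : X ⟶ Z}
    (h : j.pcoev X ≫ dual X ◁ f = j.pcoev X ≫ dual X ◁ g) : f = g := by
  rw [← cancel_epi (j.appIso X).inv]
  apply coevaluation_whiskerLeft_injective (RightRigidCategory.rightDual (dual X)).exact
  simpa [pcoev] using h

theorem appIso_tensor_inv (X Y : C) :
    (j.appIso (X ⊗ Y)).inv =
      (doubleDualTensorIso X Y).hom ≫ ((j.appIso X).inv ⊗ₘ (j.appIso Y).inv) := by
  have h : (j.appIso (X ⊗ Y)).hom ≫ (doubleDualTensorIso X Y).hom =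
    (j.appIso X).hom ⊗ₘ (j.appIso Y).hom := j.tensor X Y
  rw [← cancel_epi (j.appIso (X ⊗ Y)).hom, reassoc_of% h]
  simp

/-- Monoidality of `j` enters here: it makes the cup of a tensor product two nested cups. -/
theorem pcoev_tensor (X Y : C) :
    j.pcoev (X ⊗ Y) ≫ (dualTensorIso X Y).hom ▷ (X ⊗ Y) =
      j.pcoev Y ⊗≫ (dual Y ◁ j.pcoev X) ▷ Y ⊗≫ 𝟙 _ := by
  set d := dualTensorIso X Y
  have h₁ : coev (dual (X ⊗ Y)) ≫ d.hom ▷ _ = coev (dual Y ⊗ dual X) ≫ _ ◁ dualMap d.hom :=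
    (coev_dualMap d.hom).symm
  have h₂ : dualMap d.hom ≫ dualMap d.inv = 𝟙 _ := by
    rw [← dualMap_comp, d.inv_hom_id, dualMap_id]
  have h₃ : (doubleDualTensorIso X Y).hom =
    dualMap d.inv ≫ (dualTensorIso (dual Y) (dual X)).hom := rfl
  calc
    _ = (coev (dual (X ⊗ Y)) ≫ d.hom ▷ _) ≫ _ ◁ (j.appIso (X ⊗ Y)).inv := by
      rw [pcoev, Category.assoc, Category.assoc, whisker_exchange]
    _ = coev (dual Y ⊗ dual X) ≫ _ ◁ ((dualMap d.hom ≫ dualMap d.inv) ≫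
          (dualTensorIso (dual Y) (dual X)).hom ≫ ((j.appIso X).inv ⊗ₘ (j.appIso Y).inv)) := by
      rw [h₁, appIso_tensor_inv, h₃]; simp
    _ = (coev (dual Y ⊗ dual X) ≫ _ ◁ (dualTensorIso (dual Y) (dual X)).hom) ≫
          _ ◁ ((j.appIso X).inv ⊗ₘ (j.appIso Y).inv) := by
      rw [h₂]; simp
    _ = 𝟙 _ ⊗≫ coev (dual Y) ⊗≫ dual Y ◁ (coev (dual X) ≫ dual X ◁ (j.appIso X).inv) ▷
          dual (dual Y) ⊗≫ (dual Y ⊗ dual X ⊗ X) ◁ (j.appIso Y).inv ⊗≫ 𝟙 _ := by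
      rw [coev_dualTensorIso, MonoidalCategory.tensorHom_def]; monoidal
    _ = 𝟙 _ ⊗≫ coev (dual Y) ⊗≫ dual Y ◁ (j.pcoev X ▷ dual (dual Y) ≫
          (dual X ⊗ X) ◁ (j.appIso Y).inv) ⊗≫ 𝟙 _ := by
      rw [pcoev]; monoidal
    _ = _ := by
      rw [← whisker_exchange, pcoev, pcoev]; monoidal

end PivotalStructure

end Pivotal

/-! ### Double braidings and cups -/

section Braided

variable {C : Type u} [Category.{v} C] [MonoidalCategory C] [BraidedCategory C]

/-- The double braiding of two objects. -/
def doubleBraiding (X Y : C) : X ⊗ Y ⟶ X ⊗ Y := (β_ X Y).hom ≫ (β_ Y X).hom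

theorem doubleBraiding_tensor_left (X X' Y : C) :
    doubleBraiding (X ⊗ X') Y = (α_ _ _ _).hom ≫ X ◁ (β_ X' Y).hom ≫
      ((α_ _ _ _).inv ≫ doubleBraiding X Y ▷ X' ≫ (α_ _ _ _).hom) ≫ X ◁ (β_ Y X').hom ≫
        (α_ _ _ _).inv := by
  simp [doubleBraiding]

theorem doubleBraiding_naturality_left {X X' : C} (f : X ⟶ X') (Y : C) :
    f ▷ Y ≫ doubleBraiding X' Y = doubleBraiding X Y ≫ f ▷ Y := by
  simp [doubleBraiding]

theorem doubleBraiding_unit_right (Y : C) :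
    doubleBraiding Y (𝟙_ C) = 𝟙 _ := by
  simp [doubleBraiding]

theorem coevaluation_braiding_slide {X Y B : C} {k : 𝟙_ C ⟶ B ⊗ X} :
    k ▷ Y ⊗≫ B ◁ (β_ X Y).hom =
      𝟙 _ ⊗≫ Y ◁ k ⊗≫ (β_ B Y).inv ▷ X ⊗≫ 𝟙 _ := by
  have h := BraidedCategory.braiding_naturality_left k Y
  rw [BraidedCategory.braiding_tensor_left_hom, braiding_tensorUnit_left] at h
  calc
    _ = (k ▷ Y ≫ (α_ B X Y).hom ≫ B ◁ (β_ X Y).hom ≫ (α_ B Y X).inv ≫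
      (β_ B Y).hom ▷ X ≫ (α_ Y B X).hom) ≫ (α_ Y B X).inv ≫ (β_ B Y).inv ▷ X ⊗≫ 𝟙 _ := by
      simp [monoidalComp]
    _ = _ := by
      rw [h]; simp [monoidalComp]

/-- The graphical core of balancing. Of the four crossings in the last braiding, `B` with `Y`
cancels the one produced by the slide, `B` with `X` and `A` with `Y` restore the cups `γX` and `γY`,
and `A` with `X`, joined to the remaining crossing of `Y` with `X`, lets the cup `γY` pass the
strand `X`. -/
theorem nested_coevaluation_doubleBraiding {X Y A B : C} (γX : 𝟙_ C ⟶ X ⊗ B)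
    (γY : 𝟙_ C ⟶ Y ⊗ A) :
    (γY ≫ (β_ A Y).inv) ⊗≫ (A ◁ (γX ≫ (β_ B X).inv)) ▷ Y ⊗≫ (A ⊗ B) ◁ doubleBraiding X Y ≫
        (β_ (A ⊗ B) (X ⊗ Y)).hom =
      γX ⊗≫ (X ◁ γY) ▷ B ⊗≫ 𝟙 _ := by
  set κX := γX ≫ (β_ B X).inv with hX
  set κY := γY ≫ (β_ A Y).inv with hY
  have hX' : κX ≫ (β_ B X).hom = γX := by simp [hX]
  have hY' : κY ≫ (β_ A Y).hom = γY := by simp [hY]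
  have h := BraidedCategory.braiding_naturality_left γY X
  rw [BraidedCategory.braiding_tensor_left_hom, braiding_tensorUnit_left] at h
  calc
    _ = κY ⊗≫ A ◁ (κX ▷ Y ⊗≫ B ◁ (β_ X Y).hom) ⊗≫
          ((A ⊗ B) ◁ (β_ Y X).hom ≫ (β_ (A ⊗ B) (X ⊗ Y)).hom) := by
      rw [doubleBraiding]; monoidal
    _ = κY ⊗≫ A ◁ (𝟙 _ ⊗≫ Y ◁ κX ⊗≫ (β_ B Y).inv ▷ X ⊗≫ 𝟙 _) ⊗≫
          ((β_ (A ⊗ B) (Y ⊗ X)).hom ≫ (β_ Y X).hom ▷ (A ⊗ B)) := by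
      rw [coevaluation_braiding_slide, BraidedCategory.braiding_naturality_right]
    _ = κY ⊗≫ A ◁ (Y ◁ κX ⊗≫ ((β_ B Y).inv ≫ (β_ B Y).hom) ▷ X ⊗≫ Y ◁ (β_ B X).hom) ⊗≫
          (β_ A Y).hom ▷ (X ⊗ B) ⊗≫ Y ◁ (β_ A X).hom ▷ B ⊗≫
            (β_ Y X).hom ▷ A ▷ B ⊗≫ 𝟙 _ := by
      rw [BraidedCategory.braiding_tensor_left_hom A B (Y ⊗ X),
        BraidedCategory.braiding_tensor_right_hom B Y X,
        BraidedCategory.braiding_tensor_right_hom A Y X]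
      monoidal
    _ = κY ⊗≫ ((A ⊗ Y) ◁ (κX ≫ (β_ B X).hom) ≫
          (β_ A Y).hom ▷ (X ⊗ B)) ⊗≫ Y ◁ (β_ A X).hom ▷ B ⊗≫
            (β_ Y X).hom ▷ A ▷ B ⊗≫ 𝟙 _ := by
      rw [Iso.inv_hom_id]; monoidal
    _ = 𝟙 _ ⊗≫ ((κY ≫ (β_ A Y).hom) ▷ 𝟙_ C ≫ (Y ⊗ A) ◁ γX) ⊗≫ Y ◁ (β_ A X).hom ▷ B ⊗≫
            (β_ Y X).hom ▷ A ▷ B ⊗≫ 𝟙 _ := by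
      rw [hX', whisker_exchange]; monoidal
    _ = γX ⊗≫ (γY ▷ X ≫ (α_ Y A X).hom ≫ Y ◁ (β_ A X).hom ≫ (α_ Y X A).inv ≫
          (β_ Y X).hom ▷ A ≫ (α_ X Y A).hom) ▷ B ⊗≫ 𝟙 _ := by
      rw [hY', ← whisker_exchange]; monoidal
    _ = _ := by
      rw [h]; monoidal

end Braided

/-! ### Balancing, naturality and duality of the twist -/

section Twist

variable {C : Type u} [Category.{v} C] [MonoidalCategory C] [RightRigidCategory C]
  [BraidedCategory C]

theorem drinfeldIso_ev (X : C) :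
    (drinfeldIso X).hom ▷ dual X ≫ ev (dual X) = (β_ X (dual X)).hom ≫ ev X :=
  rightDualIso_hom_evaluation _ _

theorem coev_drinfeldIso (X : C) :
    (coev X ≫ (β_ (dual X) X).inv) ≫ dual X ◁ (drinfeldIso X).hom = coev (dual X) :=
  coevaluation_rightDualIso_hom (BraidedCategory.exactPairing_swap X (dual X))
    (RightRigidCategory.rightDual (dual X)).exact

namespace PivotalStructure

variable (j : PivotalStructure C)

/-- In `θ = u⁻¹ j` the factor `j` cancels the `j⁻¹` inside `pcoev`; what remains is the cup braided
by `u⁻¹`. -/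
theorem pcoev_twist (X : C) :
    j.pcoev X ≫ dual X ◁ (j.twist X).hom = coev X ≫ (β_ (dual X) X).inv := by
  have h : (j.twist X).hom = (j.appIso X).hom ≫ (drinfeldIso X).inv := rfl
  rw [h, whiskerLeft_comp, reassoc_of% (j.pcoev_appIso X), ← coev_drinfeldIso, Category.assoc,
    ← whiskerLeft_comp]
  simp

theorem twist_tensor (X Y : C) :
    (j.twist (X ⊗ Y)).hom = ((j.twist X).hom ⊗ₘ (j.twist Y).hom) ≫ doubleBraiding X Y := by
  apply j.pcoev_whiskerLeft_injective
  set d := dualTensorIso X Y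
  rw [← cancel_mono (d.hom ▷ (X ⊗ Y)), ← cancel_mono (β_ (dual Y ⊗ dual X) (X ⊗ Y)).hom]
  -- Once the inverse braidings are undone, both sides become the plain nested cup.
  trans coev X ⊗≫ (X ◁ coev Y) ▷ dual X ⊗≫ 𝟙 _
  · rw [pcoev_twist, ← coev_dualTensorIso]
    rw [Category.assoc, Category.assoc, ← BraidedCategory.braiding_inv_naturality_right_assoc,
      Iso.inv_hom_id, Category.comp_id]
  · symm
    calc
      _ = (j.pcoev (X ⊗ Y) ≫ d.hom ▷ (X ⊗ Y)) ≫ _ ◁ ((j.twist X).hom ⊗ₘ (j.twist Y).hom) ≫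
            _ ◁ doubleBraiding X Y ≫ (β_ (dual Y ⊗ dual X) (X ⊗ Y)).hom := by
        simp only [Category.assoc, whiskerLeft_comp, whisker_exchange_assoc]
      _ = 𝟙 _ ⊗≫ j.pcoev Y ⊗≫ dual Y ◁ (j.pcoev X ▷ Y ≫ (dual X ⊗ X) ◁ (j.twist Y).hom) ⊗≫
            dual Y ◁ dual X ◁ (j.twist X).hom ▷ Y ⊗≫
            ((dual Y ⊗ dual X) ◁ doubleBraiding X Y ≫ (β_ (dual Y ⊗ dual X) (X ⊗ Y)).hom) := by
        rw [pcoev_tensor, MonoidalCategory.tensorHom_def']; monoidal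
      _ = (j.pcoev Y ≫ dual Y ◁ (j.twist Y).hom) ⊗≫
            (dual Y ◁ (j.pcoev X ≫ dual X ◁ (j.twist X).hom)) ▷ Y ⊗≫
            (dual Y ⊗ dual X) ◁ doubleBraiding X Y ≫ (β_ (dual Y ⊗ dual X) (X ⊗ Y)).hom := by
        rw [← whisker_exchange]; monoidal
      _ = _ := by
        rw [pcoev_twist, pcoev_twist, nested_coevaluation_doubleBraiding]

theorem twist_naturality {X Y : C} (f : X ⟶ Y) :
    f ≫ (j.twist Y).hom = (j.twist X).hom ≫ f := by
  apply j.pcoev_whiskerLeft_injective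
  rw [whiskerLeft_comp, whiskerLeft_comp, ← Category.assoc, pcoev_naturality, Category.assoc,
    ← whisker_exchange, reassoc_of% (j.pcoev_twist Y), reassoc_of% (j.pcoev_twist X),
    ← BraidedCategory.braiding_inv_naturality_right, ← BraidedCategory.braiding_inv_naturality_left,
    ← Category.assoc, coev_dualMap, Category.assoc]

/-- Both sides reduce to `coev X`, an inverse braiding and `ev X`. So `X` and `X*` have the same
trace of the twist, before any sphericality. -/
theorem pcoev_twist_ev_dual (X : C) :
    j.pcoev (dual X) ≫ dual (dual X) ◁ (j.twist (dual X)).hom ≫ ev (dual X) =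
      j.pcoev X ≫ dual X ◁ (j.twist X).hom ≫ ev X := by
  rw [reassoc_of% (j.pcoev_twist X), reassoc_of% (j.pcoev_twist (dual X)), ← coev_drinfeldIso]
  rw [Category.assoc, BraidedCategory.braiding_inv_naturality_right_assoc, drinfeldIso_ev]
  simp

end PivotalStructure

end Twist

/-! ### Partial traces and encircling loops -/

section PartialTrace

variable {C : Type u} [Category.{v} C] [MonoidalCategory C] [RightRigidCategory C]

namespace PivotalStructure

variable (j : PivotalStructure C)

/-- The partial trace over the left tensor factor `X`. -/
def ptr (X : C) {Y Z : C} (f : X ⊗ Y ⟶ X ⊗ Z) : Y ⟶ Z :=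
  (λ_ Y).inv ≫ j.pcoev X ▷ Y ≫ (α_ _ _ _).hom ≫ dual X ◁ f ≫ (α_ _ _ _).inv ≫ ev X ▷ Z ≫ (λ_ Z).hom

/-- The morphism `g` slides around the loop: through the cup it becomes its dual, passes `f`, and
returns through the cap. -/
theorem ptr_cyclic {V W Y Z : C} (g : V ⟶ W) (f : W ⊗ Y ⟶ V ⊗ Z) :
    j.ptr V (g ▷ Y ≫ f) = j.ptr W (f ≫ g ▷ Z) := by
  calc
    _ = 𝟙 _ ⊗≫ (j.pcoev V ≫ dual V ◁ g) ▷ Y ⊗≫ dual V ◁ f ⊗≫ ev V ▷ Z ⊗≫ 𝟙 _ := by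
      rw [ptr]; monoidal
    _ = 𝟙 _ ⊗≫ j.pcoev W ▷ Y ⊗≫ (dualMap g ▷ (W ⊗ Y) ≫ dual V ◁ f) ⊗≫ ev V ▷ Z ⊗≫ 𝟙 _ := by
      rw [pcoev_naturality]; monoidal
    _ = 𝟙 _ ⊗≫ j.pcoev W ▷ Y ⊗≫ dual W ◁ f ⊗≫ (dualMap g ▷ V ≫ ev V) ▷ Z ⊗≫ 𝟙 _ := by
      rw [← whisker_exchange]; monoidal
    _ = _ := by
      rw [dualMap_ev, ptr]; monoidal

theorem ptr_comp (X : C) {Y Y' Z Z' : C} (a : Y ⟶ Y') (f : X ⊗ Y' ⟶ X ⊗ Z') (b : Z' ⟶ Z) :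
    j.ptr X (X ◁ a ≫ f ≫ X ◁ b) = a ≫ j.ptr X f ≫ b := by
  calc
    _ = 𝟙 _ ⊗≫ (j.pcoev X ▷ Y ≫ (dual X ⊗ X) ◁ a) ⊗≫ dual X ◁ f ⊗≫
          ((dual X ⊗ X) ◁ b ≫ ev X ▷ Z) ⊗≫ 𝟙 _ := by
      rw [ptr]; monoidal
    _ = _ := by
      rw [← whisker_exchange (j.pcoev X) a, whisker_exchange (ev X) b, ptr]; monoidal

theorem ptr_whiskerRight (X : C) {Y Z : C} (f : X ⊗ Y ⟶ X ⊗ Z) (W : C) :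
    j.ptr X ((α_ _ _ _).inv ≫ f ▷ W ≫ (α_ _ _ _).hom) = j.ptr X f ▷ W := by
  rw [ptr, ptr]; monoidal

theorem ptr_tensor (X X' : C) {Y Z : C} (f : (X ⊗ X') ⊗ Y ⟶ (X ⊗ X') ⊗ Z) :
    j.ptr (X ⊗ X') f = j.ptr X' (j.ptr X ((α_ _ _ _).inv ≫ f ≫ (α_ _ _ _).hom)) := by
  set d := dualTensorIso X X' with hd
  calc
    _ = 𝟙 _ ⊗≫ j.pcoev (X ⊗ X') ▷ Y ⊗≫ (dual (X ⊗ X') ◁ f ≫ d.hom ▷ ((X ⊗ X') ⊗ Z)) ⊗≫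
          (𝟙 ((dual X' ⊗ dual X) ⊗ X ⊗ X') ⊗≫ dual X' ◁ (ev X ▷ X') ⊗≫ ev X') ▷ Z ⊗≫ 𝟙 _ := by
      rw [ptr, ← dualTensorIso_ev, ← hd]; monoidal
    _ = 𝟙 _ ⊗≫ (j.pcoev (X ⊗ X') ≫ d.hom ▷ (X ⊗ X')) ▷ Y ⊗≫ (dual X' ⊗ dual X) ◁ f ⊗≫
          (𝟙 ((dual X' ⊗ dual X) ⊗ X ⊗ X') ⊗≫ dual X' ◁ (ev X ▷ X') ⊗≫ ev X') ▷ Z ⊗≫ 𝟙 _ := by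
      rw [whisker_exchange]; monoidal
    _ = _ := by
      rw [pcoev_tensor, ptr, ptr]; monoidal

theorem trace_eq (X : C) (f : X ⟶ X) : j.trace f = j.pcoev X ≫ dual X ◁ f ≫ ev X := by
  rw [trace, pcoev, Category.assoc]

theorem ptr_whiskerRight_unit (X : C) (f : X ⟶ X) : j.ptr X (f ▷ 𝟙_ C) = j.trace f := by
  rw [trace_eq, ptr]
  calc
    _ = (λ_ _).inv ≫ (j.pcoev X ≫ dual X ◁ f ≫ ev X) ▷ 𝟙_ C ≫ (λ_ _).hom := by monoidal
    _ = _ := by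
      rw [unitors_equal]; simp only [rightUnitor_naturality, unitors_inv_equal, Iso.inv_hom_id_assoc]

theorem trace_tensor (X Y : C) (f : X ⊗ Y ⟶ X ⊗ Y) : j.trace f = j.trace (j.ptr X f) := by
  rw [← ptr_whiskerRight_unit, ← ptr_whiskerRight_unit, ptr_tensor, ptr_whiskerRight]

variable [BraidedCategory C]

/-- The endomorphism of `Y` given by a loop labelled by `X` around `Y`. -/
def encircle (X Y : C) : Y ⟶ Y := j.ptr X (doubleBraiding X Y)

/-- By the hexagon axioms a loop labelled by a tensor product is a pair of nested loops. This is the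
source of multiplicativity. -/
theorem encircle_tensor (X X' Y : C) :
    j.encircle (X ⊗ X') Y =
      j.ptr X' ((β_ X' Y).hom ≫ j.encircle X Y ▷ X' ≫ (β_ Y X').hom) := by
  rw [encircle, ptr_tensor, doubleBraiding_tensor_left, encircle, ← ptr_whiskerRight, ← ptr_comp]
  simp

theorem encircle_unit (X : C) : j.encircle X (𝟙_ C) = j.trace (𝟙 X) := by
  rw [encircle, doubleBraiding_unit_right, ← ptr_whiskerRight_unit, id_whiskerRight]

theorem trace_doubleBraiding (X Y : C) : j.trace (doubleBraiding X Y) = j.trace (j.encircle X Y) :=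
  j.trace_tensor X Y _

end PivotalStructure

end PartialTrace

open Module

/-! ### Direct sum decompositions and additive invariants -/

section Splitting

variable {C : Type u} [Category.{v} C] [Abelian C]

/-- A decomposition of `X` as a finite direct sum, in terms of inclusions and projections. -/
structure Splitting (X : C) {n : ℕ} (S : Fin n → C) where
  /-- The projections. -/
  π (k : Fin n) : X ⟶ S k
  /-- The inclusions. -/
  ι (k : Fin n) : S k ⟶ X
  ι_π_self (k : Fin n) : ι k ≫ π k = 𝟙 (S k)
  ι_π_ne {k l : Fin n} (h : k ≠ l) : ι k ≫ π l = 0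
  total : ∑ k, π k ≫ ι k = 𝟙 X

/-- The image of a splitting under an additive functor. -/
def Splitting.map {X : C} {n : ℕ} {S : Fin n → C} (s : Splitting X S) (F : C ⥤ C) [F.Additive] :
    Splitting (F.obj X) (fun k => F.obj (S k)) where
  π k := F.map (s.π k)
  ι k := F.map (s.ι k)
  ι_π_self k := by rw [← F.map_comp, s.ι_π_self, F.map_id]
  ι_π_ne h := by rw [← F.map_comp, s.ι_π_ne h, F.map_zero]
  total := by simp_rw [← F.map_comp, ← F.map_sum, s.total, F.map_id]

/-- An isomorphism as a splitting with one summand. -/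
def Splitting.ofIso {X Y : C} (e : X ≅ Y) : Splitting X (fun _ : Fin 1 => Y) where
  π _ := e.hom
  ι _ := e.inv
  ι_π_self _ := e.inv_hom_id
  ι_π_ne h := (h (Subsingleton.elim _ _)).elim
  total := by simp

/-- A numerical invariant of objects that is additive on finite direct sums. -/
def IsAdditive (g : C → ℂ) : Prop :=
  ∀ ⦃X : C⦄ ⦃n : ℕ⦄ ⦃S : Fin n → C⦄, Splitting X S → g X = ∑ k, g (S k)

theorem IsAdditive.iso {g : C → ℂ} (hg : IsAdditive g) {X Y : C} (e : X ≅ Y) : g X = g Y := by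
  simpa using hg (Splitting.ofIso e)

/-- The class of a simple object. -/
def SimpleClass.mk (X : C) [h : Simple X] : SimpleClass C := Quotient.mk (simpleSetoid C) ⟨X, h⟩

theorem SimpleClass.nonempty_iso_mk (X : C) [h : Simple X] : Nonempty ((SimpleClass.mk X).obj ≅ X) :=
  Quotient.exact (s := simpleSetoid C) (Quotient.out_eq (SimpleClass.mk X))

theorem SimpleClass.mk_eq_mk {X Y : C} [Simple X] [Simple Y] (e : X ≅ Y) :
    SimpleClass.mk X = SimpleClass.mk Y :=
  Quotient.sound (s := simpleSetoid C) ⟨e⟩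

theorem SimpleClass.mk_obj (x : SimpleClass C) : SimpleClass.mk x.obj = x :=
  Quotient.out_eq x

variable [Linear ℂ C]

/-- The decomposition of a Hom space induced by a splitting of its source. -/
def Splitting.homEquiv {X : C} {n : ℕ} {S : Fin n → C} (s : Splitting X S) (W : C) :
    (X ⟶ W) ≃ₗ[ℂ] (∀ k, S k ⟶ W) where
  toFun f k := s.ι k ≫ f
  map_add' f g := by ext; simp
  map_smul' c f := by ext; simp
  invFun f := ∑ k, s.π k ≫ f k
  left_inv f := by
    simp_rw [← Category.assoc, ← Preadditive.sum_comp, s.total, Category.id_comp]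
  right_inv f := by
    ext l
    dsimp only
    rw [Preadditive.comp_sum, Finset.sum_eq_single l]
    · rw [← Category.assoc, s.ι_π_self, Category.id_comp]
    · intro k _ hk
      rw [← Category.assoc, s.ι_π_ne hk.symm, zero_comp]
    · simp

/-- The decomposition of a Hom space induced by a splitting of its target. -/
def Splitting.homEquiv' {X : C} {n : ℕ} {S : Fin n → C} (s : Splitting X S) (W : C) :
    (W ⟶ X) ≃ₗ[ℂ] (∀ k, W ⟶ S k) where
  toFun f k := f ≫ s.π k
  map_add' f g := by ext; simp
  map_smul' c f := by ext; simp
  invFun f := ∑ k, f k ≫ s.ι k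
  left_inv f := by
    simp_rw [Category.assoc, ← Preadditive.comp_sum, s.total, Category.comp_id]
  right_inv f := by
    ext l
    dsimp only
    rw [Preadditive.sum_comp, Finset.sum_eq_single l]
    · rw [Category.assoc, s.ι_π_self, Category.comp_id]
    · intro k _ hk
      rw [Category.assoc, s.ι_π_ne hk, comp_zero]
    · simp

end Splitting

/-! ### Linear Frobenius reciprocity -/

section Rigid

variable {C : Type u} [Category.{v} C] [Abelian C] [Linear ℂ C] [MonoidalCategory C]
  [MonoidalPreadditive C] [MonoidalLinear ℂ C] [RigidCategory C]

/-- Frobenius reciprocity for tensoring on the left, as a linear equivalence. -/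
def tensorLeftHomLinearEquiv (X Y Y' Z : C) [ExactPairing Y Y'] :
    (Y' ⊗ X ⟶ Z) ≃ₗ[ℂ] (X ⟶ Y ⊗ Z) where
  __ := tensorLeftHomEquiv X Y Y' Z
  map_add' f g := by simp [tensorLeftHomEquiv, MonoidalPreadditive.whiskerLeft_add]
  map_smul' c f := by simp [tensorLeftHomEquiv, MonoidalLinear.whiskerLeft_smul]

/-- Frobenius reciprocity for tensoring on the right, as a linear equivalence. -/
def tensorRightHomLinearEquiv (X Y Y' Z : C) [ExactPairing Y Y'] :
    (X ⊗ Y ⟶ Z) ≃ₗ[ℂ] (X ⟶ Z ⊗ Y') where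
  __ := tensorRightHomEquiv X Y Y' Z
  map_add' f g := by simp [tensorRightHomEquiv, MonoidalPreadditive.add_whiskerRight]
  map_smul' c f := by simp [tensorRightHomEquiv, MonoidalLinear.smul_whiskerRight]

/-- Postcomposition with an isomorphism as a linear equivalence. -/
def homCongrRight (X : C) {Y Z : C} (e : Y ≅ Z) : (X ⟶ Y) ≃ₗ[ℂ] (X ⟶ Z) where
  toFun f := f ≫ e.hom
  invFun f := f ≫ e.inv
  map_add' f g := by simp
  map_smul' c f := by simp
  left_inv f := by simp
  right_inv f := by simp

theorem finrank_dual_tensor_unit (X : C) :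
    finrank ℂ (dual X ⊗ X ⟶ 𝟙_ C) = finrank ℂ (X ⟶ X) := by
  rw [(tensorLeftHomLinearEquiv X X (dual X) (𝟙_ C)).finrank_eq,
    (homCongrRight X (ρ_ X)).finrank_eq]

theorem finrank_end_dual (X : C) : finrank ℂ (dual X ⟶ dual X) = finrank ℂ (X ⟶ X) := by
  rw [← finrank_dual_tensor_unit X, (tensorRightHomLinearEquiv (dual X) X (dual X) (𝟙_ C)).finrank_eq,
    (homCongrRight (dual X) (λ_ (dual X))).finrank_eq]

end Rigid

/-! ### Multiplicities of simple objects -/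

section Fusion

variable {C : Type u} [Category.{v} C] [Abelian C] [Linear ℂ C] [MonoidalCategory C]
  [MonoidalPreadditive C] [MonoidalLinear ℂ C] [RigidCategory C] [IsFusion C]

attribute [local instance] Abelian.hasFiniteBiproducts

theorem exists_splitting (X : C) : ∃ (n : ℕ) (S : Fin n → C),
    (∀ k, Simple (S k)) ∧ Nonempty (Splitting X S) := by
  obtain ⟨n, S, hS, ⟨e⟩⟩ := IsFusion.semisimple X
  refine ⟨n, S, hS, ⟨⟨fun k => e.hom ≫ biproduct.π S k, fun k => biproduct.ι S k ≫ e.inv, ?_, ?_,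
    ?_⟩⟩⟩
  · simp
  · intro k l h
    simp [biproduct.ι_π_ne S h]
  · calc
      _ = e.hom ≫ (∑ k, biproduct.π S k ≫ biproduct.ι S k) ≫ e.inv := by
        simp only [Preadditive.comp_sum, Preadditive.sum_comp, Category.assoc]
      _ = _ := by rw [biproduct.total]; simp

theorem isAdditive_finrank_hom_left (W : C) :
    IsAdditive (fun X : C => (finrank ℂ (X ⟶ W) : ℂ)) := by
  intro X n S s
  simp only [(s.homEquiv W).finrank_eq, finrank_pi_fintype ℂ, Nat.cast_sum]

theorem isAdditive_finrank_hom_right (W : C) :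
    IsAdditive (fun X : C => (finrank ℂ (W ⟶ X) : ℂ)) := by
  intro X n S s
  simp only [(s.homEquiv' W).finrank_eq, finrank_pi_fintype ℂ, Nat.cast_sum]

theorem finrank_hom_simple_simple_comm (X Y : C) [Simple X] [Simple Y] :
    finrank ℂ (X ⟶ Y) = finrank ℂ (Y ⟶ X) := by
  classical
  rw [finrank_hom_simple_simple ℂ X Y, finrank_hom_simple_simple ℂ Y X]
  exact if_congr ⟨fun ⟨e⟩ => ⟨e.symm⟩, fun ⟨e⟩ => ⟨e.symm⟩⟩ rfl rfl

open Classical in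
theorem finrank_hom_simpleClass (X : C) [Simple X] (z : SimpleClass C) :
    finrank ℂ (X ⟶ z.obj) = if z = SimpleClass.mk X then 1 else 0 := by
  rw [finrank_hom_simple_simple ℂ X z.obj]
  refine if_congr ⟨fun ⟨e⟩ => ?_, fun h => ?_⟩ rfl rfl
  · rw [SimpleClass.mk_eq_mk e, SimpleClass.mk_obj]
  · rw [h]
    exact (SimpleClass.nonempty_iso_mk X).map Iso.symm

/-- By Schur's lemma `dim Hom(X, z)` is the multiplicity of `z` in `X`. -/
theorem IsAdditive.eq_sum {g : C → ℂ} (hg : IsAdditive g) (X : C) :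
    g X = ∑ z : SimpleClass C, (finrank ℂ (X ⟶ z.obj) : ℂ) * g z.obj := by
  classical
  obtain ⟨n, S, hS, ⟨s⟩⟩ := exists_splitting X
  simp_rw [isAdditive_finrank_hom_left _ s, Finset.sum_mul]
  rw [Finset.sum_comm, hg s]
  refine Finset.sum_congr rfl fun k _ => ?_
  have := hS k
  simp only [finrank_hom_simpleClass, Nat.cast_ite, Nat.cast_one, Nat.cast_zero, ite_mul, one_mul,
    zero_mul, Finset.sum_ite_eq', Finset.mem_univ, if_true]
  exact hg.iso (SimpleClass.nonempty_iso_mk (S k)).some.symm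

theorem finrank_hom_simple_comm (X W : C) [Simple W] :
    finrank ℂ (X ⟶ W) = finrank ℂ (W ⟶ X) := by
  have h₁ := (isAdditive_finrank_hom_left W).eq_sum X
  have h₂ := (isAdditive_finrank_hom_right W).eq_sum X
  simp only [finrank_hom_simple_simple_comm _ W] at h₁
  exact_mod_cast h₁.trans h₂.symm

/-- Semisimplicity reverses the Hom space, and then adjunction applies. For simple `Z` it says that
`X*` has the transposed fusion matrix of `X`. -/
theorem finrank_tensor_hom (X Z W : C) [Simple W] :
    finrank ℂ (X ⊗ Z ⟶ W) = finrank ℂ (dual X ⊗ W ⟶ Z) := by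
  rw [finrank_hom_simple_comm, (tensorLeftHomLinearEquiv W X (dual X) Z).finrank_eq]

/-- Each simple summand contributes at least one dimension to `End X`, so there is exactly one
summand. -/
theorem simple_of_finrank_end_eq_one {X : C} (h : finrank ℂ (X ⟶ X) = 1) : Simple X := by
  obtain ⟨n, S, hS, ⟨s⟩⟩ := exists_splitting X
  have h₁ : ∑ k, finrank ℂ (S k ⟶ X) = 1 := by
    rw [← h, (s.homEquiv X).finrank_eq, finrank_pi_fintype ℂ]
  have h₂ : ∀ k, 1 ≤ finrank ℂ (S k ⟶ X) := by
    intro k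
    have : Nontrivial (S k ⟶ X) := by
      refine ⟨s.ι k, 0, fun h0 => id_nonzero (S k) ?_⟩
      rw [← s.ι_π_self, h0, zero_comp]
    exact finrank_pos
  have h₃ : n ≤ 1 := by
    have := Finset.sum_le_sum (s := Finset.univ) fun k _ => h₂ k
    simpa [h₁] using this
  obtain rfl : n = 1 := by
    rcases Nat.le_one_iff_eq_zero_or_eq_one.mp h₃ with rfl | h
    · simp at h₁
    · exact h
  have e : X ≅ S 0 := ⟨s.π 0, s.ι 0, by simpa using s.total, s.ι_π_self 0⟩
  exact Simple.of_iso e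

instance simple_dual (X : C) [Simple X] : Simple (dual X) :=
  simple_of_finrank_end_eq_one
    ((finrank_end_dual X).trans (finrank_endomorphism_simple_eq_one ℂ X))

/-- A nonzero morphism out of a simple object does not vanish on all projections. -/
theorem exists_comp_eq_id {X Y : C} [Simple X] {f : X ⟶ Y} (hf : f ≠ 0) :
    ∃ r : Y ⟶ X, f ≫ r = 𝟙 X := by
  obtain ⟨n, S, hS, ⟨s⟩⟩ := exists_splitting Y
  by_contra! h
  apply hf
  have : ∀ k, f ≫ s.π k = 0 := by
    intro k
    by_contra hk
    have := isIso_of_hom_simple hk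
    exact h (s.π k ≫ inv (f ≫ s.π k)) (by rw [← Category.assoc, IsIso.hom_inv_id])
  rw [← Category.comp_id f, ← s.total, Preadditive.comp_sum]
  exact Finset.sum_eq_zero fun k _ => by rw [← Category.assoc, this, zero_comp]

end Fusion

/-! ### Linearity and additivity of partial traces -/

section Rigid

variable {C : Type u} [Category.{v} C] [Abelian C] [Linear ℂ C] [MonoidalCategory C]
  [MonoidalPreadditive C] [MonoidalLinear ℂ C] [RigidCategory C]

namespace PivotalStructure

variable (j : PivotalStructure C)

/-- The partial trace as a linear map. -/
def ptrHom (X Y Z : C) : (X ⊗ Y ⟶ X ⊗ Z) →ₗ[ℂ] (Y ⟶ Z) where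
  toFun := j.ptr X
  map_add' f g := by simp [ptr, MonoidalPreadditive.whiskerLeft_add]
  map_smul' c f := by simp [ptr, MonoidalLinear.whiskerLeft_smul]

theorem ptr_smul (X : C) {Y Z : C} (c : ℂ) (f : X ⊗ Y ⟶ X ⊗ Z) :
    j.ptr X (c • f) = c • j.ptr X f :=
  (j.ptrHom X Y Z).map_smul c f

theorem trace_smul {X : C} (c : ℂ) (f : X ⟶ X) : j.trace (c • f) = c • j.trace f := by
  rw [← ptr_whiskerRight_unit, ← ptr_whiskerRight_unit, MonoidalLinear.smul_whiskerRight, ptr_smul]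

/-- Partial traces of natural endomorphisms are additive. -/
theorem ptr_splitting {Y : C} (t : ∀ X : C, X ⊗ Y ⟶ X ⊗ Y)
    (ht : ∀ {X X' : C} (f : X ⟶ X'), f ▷ Y ≫ t X' = t X ≫ f ▷ Y)
    {X : C} {n : ℕ} {S : Fin n → C} (s : Splitting X S) :
    j.ptr X (t X) = ∑ k, j.ptr (S k) (t (S k)) := by
  have h : t X = ∑ k, s.π k ▷ Y ≫ s.ι k ▷ Y ≫ t X := by
    simp_rw [← comp_whiskerRight_assoc, ← Preadditive.sum_comp, ← sum_whiskerRight, s.total]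
    simp
  calc
    _ = j.ptrHom X Y Y (∑ k, s.π k ▷ Y ≫ s.ι k ▷ Y ≫ t X) := by rw [← h]; rfl
    _ = ∑ k, j.ptr X (s.π k ▷ Y ≫ s.ι k ▷ Y ≫ t X) := map_sum _ _ _
    _ = _ := by
      refine Finset.sum_congr rfl fun k _ => ?_
      rw [ptr_cyclic, ht, Category.assoc, ← comp_whiskerRight, s.ι_π_self, id_whiskerRight,
        Category.comp_id]

end PivotalStructure

end Rigid

/-! ### Dimensions and characters of the fusion ring -/

section Fusion

variable {C : Type u} [Category.{v} C] [Abelian C] [Linear ℂ C] [MonoidalCategory C]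
  [MonoidalPreadditive C] [MonoidalLinear ℂ C] [RigidCategory C] [IsFusion C]

/-- `scalar` as a linear functional. -/
def scalarHom (X : C) [Simple X] : (X ⟶ X) →ₗ[ℂ] ℂ where
  toFun := scalar
  map_add' f g := scalar_eq (by rw [add_smul, scalar_smul_id, scalar_smul_id])
  map_smul' c f := scalar_eq (by rw [smul_eq_mul, mul_smul, scalar_smul_id, RingHom.id_apply])

theorem scalar_id (X : C) [Simple X] : scalar (𝟙 X) = 1 := scalar_eq (one_smul _ _).symm

theorem scalar_smul {X : C} [Simple X] (c : ℂ) (f : X ⟶ X) : scalar (c • f) = c * scalar f :=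
  (scalarHom X).map_smul c f

theorem scalar_sum {X : C} [Simple X] {n : ℕ} (f : Fin n → (X ⟶ X)) :
    scalar (∑ k, f k) = ∑ k, scalar (f k) :=
  map_sum (scalarHom X) f _

theorem scalar_comp {X : C} [Simple X] (f g : X ⟶ X) : scalar (f ≫ g) = scalar f * scalar g :=
  scalar_eq (by
    conv_lhs => rw [← scalar_smul_id f, ← scalar_smul_id g]
    rw [Linear.smul_comp, Category.id_comp, mul_smul])

theorem scalar_ne_zero {X : C} [Simple X] (e : X ≅ X) : scalar e.hom ≠ 0 := by
  intro h
  have := scalar_comp e.hom e.inv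
  rw [e.hom_inv_id, scalar_id, h, zero_mul] at this
  exact one_ne_zero this

theorem scalar_iso_conj {X Y : C} [Simple X] [Simple Y] (e : X ≅ Y) (f : X ⟶ X) (g : Y ⟶ Y)
    (h : f ≫ e.hom = e.hom ≫ g) : scalar f = scalar g := by
  apply scalar_eq
  rw [← cancel_mono e.hom, h, Linear.smul_comp, Category.id_comp, ← scalar_smul_id g,
    Linear.comp_smul, Category.comp_id, scalar_smul_id]

namespace PivotalStructure

variable (j : PivotalStructure C)

theorem scalar_trace {X : C} [Simple X] (f : X ⟶ X) :
    scalar (j.trace f) = scalar f * j.dim X := by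
  conv_lhs => rw [← scalar_smul_id f]
  rw [trace_smul, scalar_smul, dim]

theorem isAdditive_dim : IsAdditive j.dim := by
  intro X n S s
  have := j.ptr_splitting (Y := 𝟙_ C) (fun X => 𝟙 X ▷ 𝟙_ C) (by simp) s
  simp only [ptr_whiskerRight_unit] at this
  simp only [dim, this, scalar_sum]

theorem eq_smul_ev {X : C} [Simple X] (r : dual X ⊗ X ⟶ 𝟙_ C) : ∃ c : ℂ, r = c • ev X := by
  have h : ev X = (tensorLeftHomLinearEquiv X X (dual X) (𝟙_ C)).symm (ρ_ X).inv := by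
    rw [LinearEquiv.eq_symm_apply]
    change (λ_ X).inv ≫ coev X ▷ X ≫ (α_ _ _ _).hom ≫ X ◁ ev X = _
    simp
  have h₁ : finrank ℂ (dual X ⊗ X ⟶ 𝟙_ C) = 1 :=
    (finrank_dual_tensor_unit X).trans (finrank_endomorphism_simple_eq_one ℂ X)
  have h₂ : ev X ≠ 0 := by
    rw [h, Ne, LinearEquiv.map_eq_zero_iff]
    intro h0
    apply id_nonzero X
    rw [← (ρ_ X).inv_hom_id, h0, zero_comp]
  obtain ⟨c, hc⟩ := (finrank_eq_one_iff_of_nonzero' _ h₂).mp h₁ r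
  exact ⟨c, hc.symm⟩

/-- The cup `pcoev X` is split by semisimplicity, and its retraction must be a multiple of `ev X`.
Hence `pcoev X ≫ ev X`, which is the dimension, cannot vanish. -/
theorem dim_ne_zero (X : C) [Simple X] : j.dim X ≠ 0 := by
  intro h
  have h₀ : j.pcoev X ≠ 0 := by
    intro h0
    apply id_nonzero X
    apply j.pcoev_whiskerLeft_injective
    rw [h0, zero_comp, zero_comp]
  obtain ⟨r, hr⟩ := exists_comp_eq_id h₀
  obtain ⟨c, rfl⟩ := eq_smul_ev r
  have h₁ : j.pcoev X ≫ ev X = 0 := by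
    have : j.trace (𝟙 X) = 0 := by
      rw [← scalar_smul_id (j.trace (𝟙 X)), ← dim, h, zero_smul]
    simpa [trace_eq] using this
  rw [Linear.comp_smul, h₁, smul_zero] at hr
  exact id_nonzero _ hr.symm

variable [BraidedCategory C]

/-- The scalar by which a loop labelled by `X` acts on a simple object `Y`. -/
def encircleScalar (X Y : C) [Simple Y] : ℂ := scalar (j.encircle X Y)

theorem isAdditive_encircleScalar (Y : C) [Simple Y] :
    IsAdditive (fun X => j.encircleScalar X Y) := by
  intro X n S s
  have := j.ptr_splitting (Y := Y) (fun X => doubleBraiding X Y)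
    (fun f => doubleBraiding_naturality_left f Y) s
  simp only [encircleScalar, encircle, this, scalar_sum]

/-- The inner of the two nested loops acts on the simple `Y` by a scalar, which factors out and
leaves the outer loop. -/
theorem encircleScalar_tensor (X X' Y : C) [Simple Y] :
    j.encircleScalar (X ⊗ X') Y = j.encircleScalar X Y * j.encircleScalar X' Y := by
  rw [encircleScalar, encircle_tensor, ← scalar_smul_id (j.encircle X Y),
    MonoidalLinear.smul_whiskerRight, id_whiskerRight, Linear.smul_comp, Linear.comp_smul,
    ptr_smul, scalar_smul, Category.id_comp]
  rfl

theorem encircleScalar_unit (X : C) : j.encircleScalar X (𝟙_ C) = j.dim X := by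
  rw [encircleScalar, encircle_unit, dim]

theorem dim_tensor (X Y : C) : j.dim (X ⊗ Y) = j.dim X * j.dim Y := by
  simp only [← encircleScalar_unit, encircleScalar_tensor]

/-- The trace of the twist. -/
def twistTrace (X : C) : ℂ := scalar (j.trace (j.twist X).hom)

theorem isAdditive_twistTrace : IsAdditive j.twistTrace := by
  intro X n S s
  have := j.ptr_splitting (Y := 𝟙_ C) (fun X => (j.twist X).hom ▷ 𝟙_ C)
    (fun f => by rw [← comp_whiskerRight, twist_naturality, comp_whiskerRight]) s
  simp only [ptr_whiskerRight_unit] at this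
  simp only [twistTrace, this, scalar_sum]

theorem twistTrace_eq (X : C) [Simple X] :
    j.twistTrace X = scalar (j.twist X).hom * j.dim X :=
  j.scalar_trace _

theorem twist_tensor_simple (X Y : C) [Simple X] [Simple Y] :
    (j.twist (X ⊗ Y)).hom =
      (scalar (j.twist X).hom * scalar (j.twist Y).hom) • doubleBraiding X Y := by
  rw [twist_tensor]
  conv_lhs => rw [← scalar_smul_id (j.twist X).hom, ← scalar_smul_id (j.twist Y).hom]
  rw [MonoidalCategory.tensorHom_def, MonoidalLinear.smul_whiskerRight,
    MonoidalLinear.whiskerLeft_smul, Linear.smul_comp, Linear.comp_smul, smul_smul,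
    Linear.smul_comp]
  simp

theorem twistTrace_tensor (X Y : C) [Simple X] [Simple Y] :
    j.twistTrace (X ⊗ Y) = scalar (j.twist X).hom * scalar (j.twist Y).hom *
      (j.encircleScalar X Y * j.dim Y) := by
  rw [twistTrace, twist_tensor_simple, trace_smul, scalar_smul, trace_doubleBraiding, scalar_trace,
    encircleScalar]

end PivotalStructure

/-- The fusion coefficients attached to `X* ⊗ -` are the transposes of those of `X ⊗ -`, hence
characters of the fusion ring of a braided category are `*`-characters. -/
theorem character_dual {g : C → ℂ} (hg : IsAdditive g) (hm : ∀ X Y, g (X ⊗ Y) = g X * g Y) (X : C) :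
    g (dual X) = starRingEnd ℂ (g X) := by
  -- `s` is the squared norm of the vector `(g z)`, a common eigenvector of the fusion matrices.
  -- Moving the matrix of `X*` across the Hermitian form transposes it into that of `X`, which has
  -- real entries.
  set s : ℂ := ∑ z : SimpleClass C, starRingEnd ℂ (g z.obj) * g z.obj with hs
  have key : g (dual X) * s = starRingEnd ℂ (g X) * s := by
    calc
      _ = ∑ w : SimpleClass C, starRingEnd ℂ (g w.obj) * g (dual X ⊗ w.obj) := by
        rw [hs, Finset.mul_sum]
        refine Finset.sum_congr rfl fun w _ => ?_
        rw [hm]; ring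
      _ = ∑ w : SimpleClass C, ∑ z : SimpleClass C,
            starRingEnd ℂ (g w.obj) * ((finrank ℂ (X ⊗ z.obj ⟶ w.obj) : ℂ) * g z.obj) := by
        refine Finset.sum_congr rfl fun w _ => ?_
        rw [hg.eq_sum (dual X ⊗ w.obj), Finset.mul_sum]
        refine Finset.sum_congr rfl fun z _ => ?_
        rw [finrank_tensor_hom X]
      _ = ∑ z : SimpleClass C, starRingEnd ℂ (g (X ⊗ z.obj)) * g z.obj := by
        rw [Finset.sum_comm]
        refine Finset.sum_congr rfl fun z _ => ?_
        rw [hg.eq_sum (X ⊗ z.obj), map_sum, Finset.sum_mul]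
        refine Finset.sum_congr rfl fun w _ => ?_
        rw [map_mul, map_natCast]; ring
      _ = _ := by
        rw [hs, Finset.mul_sum]
        refine Finset.sum_congr rfl fun w _ => ?_
        rw [hm, map_mul]; ring
  -- If `s = 0`, then `g` vanishes on all simple objects and hence everywhere.
  by_cases h : s = 0
  · have hz : ∀ z : SimpleClass C, g z.obj = 0 := by
      have h' : ∑ z : SimpleClass C, Complex.normSq (g z.obj) = 0 := by
        have : ((∑ z : SimpleClass C, Complex.normSq (g z.obj) : ℝ) : ℂ) = 0 := by
          rw [← h, hs, Complex.ofReal_sum]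
          exact Finset.sum_congr rfl fun z _ => Complex.normSq_eq_conj_mul_self
        exact_mod_cast this
      intro z
      exact Complex.normSq_eq_zero.mp
        ((Finset.sum_eq_zero_iff_of_nonneg fun z _ => Complex.normSq_nonneg _).mp h' z
          (Finset.mem_univ z))
    rw [hg.eq_sum X, hg.eq_sum (dual X)]
    simp [hz]
  · exact mul_right_cancel₀ h key

end Fusion

/-! ### Bounding determinants by eigenvalues -/

section Determinant

theorem norm_multiset_prod_le {s : Multiset ℂ} {M : ℝ} (hM : ∀ μ ∈ s, ‖μ‖ ≤ M) :
    ‖s.prod‖ ≤ M ^ s.card := by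
  induction s using Multiset.induction_on with
  | empty => simp
  | cons a s ih =>
    rw [Multiset.prod_cons, Multiset.card_cons, pow_succ', norm_mul]
    have h := hM a (Multiset.mem_cons_self a s)
    exact mul_le_mul h (ih fun μ hμ => hM μ (Multiset.mem_cons_of_mem hμ)) (norm_nonneg _)
      ((norm_nonneg _).trans h)

theorem le_norm_multiset_prod {s : Multiset ℂ} {m : ℝ} (hm₀ : 0 ≤ m) (hm : ∀ μ ∈ s, m ≤ ‖μ‖) :
    m ^ s.card ≤ ‖s.prod‖ := by
  induction s using Multiset.induction_on with
  | empty => simp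
  | cons a s ih =>
    rw [Multiset.prod_cons, Multiset.card_cons, pow_succ', norm_mul]
    exact mul_le_mul (hm a (Multiset.mem_cons_self a s))
      (ih fun μ hμ => hm μ (Multiset.mem_cons_of_mem hμ)) (pow_nonneg hm₀ _) (norm_nonneg _)

variable {V : Type*} [AddCommGroup V] [Module ℂ V] [FiniteDimensional ℂ V] (T : End ℂ V)

theorem card_roots_charpoly : T.charpoly.roots.card = finrank ℂ V := by
  rw [← T.charpoly_natDegree]
  exact (Polynomial.splits_iff_card_roots.mp (IsAlgClosed.splits _))

theorem hasEigenvalue_of_mem_roots {μ : ℂ} (h : μ ∈ T.charpoly.roots) : T.HasEigenvalue μ :=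
  (Module.End.hasEigenvalue_iff_isRoot_charpoly T μ).mpr (Polynomial.isRoot_of_mem_roots h)

theorem norm_det_le {M : ℝ} (hM : ∀ μ, T.HasEigenvalue μ → ‖μ‖ ≤ M) :
    ‖LinearMap.det T‖ ≤ M ^ finrank ℂ V := by
  rw [Module.End.det_eq_prod_roots_charpoly_of_splits (IsAlgClosed.splits _),
    ← card_roots_charpoly T]
  exact norm_multiset_prod_le fun μ hμ => hM μ (hasEigenvalue_of_mem_roots T hμ)

theorem le_norm_det {m : ℝ} (hm₀ : 0 ≤ m) (hm : ∀ μ, T.HasEigenvalue μ → m ≤ ‖μ‖) :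
    m ^ finrank ℂ V ≤ ‖LinearMap.det T‖ := by
  rw [Module.End.det_eq_prod_roots_charpoly_of_splits (IsAlgClosed.splits _),
    ← card_roots_charpoly T]
  exact le_norm_multiset_prod hm₀ fun μ hμ => hm μ (hasEigenvalue_of_mem_roots T hμ)

end Determinant

/-! ### Determinants of postcomposition -/

section Linear

variable {C : Type u} [Category.{v} C] [Abelian C] [Linear ℂ C]

theorem det_rightComp_conj (W : C) {Y Z : C} (e : Y ≅ Z) (t : Z ⟶ Z) :
    LinearMap.det (Linear.rightComp ℂ W (e.hom ≫ t ≫ e.inv)) =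
      LinearMap.det (Linear.rightComp ℂ W t) := by
  rw [← LinearMap.det_conj (Linear.rightComp ℂ W t) (homCongrRight W e.symm)]
  congr 1
  ext f
  simp [homCongrRight]

theorem det_rightComp_comp (W : C) {Y : C} (s t : Y ⟶ Y) :
    LinearMap.det (Linear.rightComp ℂ W (s ≫ t)) =
      LinearMap.det (Linear.rightComp ℂ W s) * LinearMap.det (Linear.rightComp ℂ W t) := by
  rw [mul_comm, ← LinearMap.det_comp]
  congr 1
  ext f
  simp

variable [MonoidalCategory C] [RigidCategory C] [BraidedCategory C]

theorem finrank_hom_tensor_dual_tensor_eq (X : C) :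
    finrank ℂ (X ⟶ (X ⊗ X) ⊗ dual X) = finrank ℂ (X ⟶ (X ⊗ dual X) ⊗ X) ∧
      finrank ℂ (X ⟶ X ⊗ dual X ⊗ X) = finrank ℂ (X ⟶ (X ⊗ dual X) ⊗ X) :=
  ⟨(homCongrRight X (α_ _ _ _ ≪≫ whiskerLeftIso X (β_ X (dual X)) ≪≫ (α_ _ _ _).symm)).finrank_eq,
    (homCongrRight X (α_ _ _ _).symm).finrank_eq⟩

end Linear

/-! ### Twists have modulus one -/

section Fusion

variable {C : Type u} [Category.{v} C] [Abelian C] [Linear ℂ C] [MonoidalCategory C]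
  [MonoidalPreadditive C] [MonoidalLinear ℂ C] [RigidCategory C] [IsFusion C]

theorem finrank_hom_tensor_dual_tensor_pos (X : C) [Simple X] :
    0 < finrank ℂ (X ⟶ (X ⊗ dual X) ⊗ X) := by
  have : Nontrivial (X ⟶ (X ⊗ dual X) ⊗ X) := by
    refine ⟨(λ_ X).inv ≫ coev X ▷ X, 0, fun h => id_nonzero X ?_⟩
    calc
      𝟙 X = ((λ_ X).inv ≫ coev X ▷ X) ≫ (α_ _ _ _).hom ≫ X ◁ ev X ≫ (ρ_ X).hom := by simp
      _ = 0 := by rw [h, zero_comp]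
  exact finrank_pos

variable [BraidedCategory C]

namespace PivotalStructure

variable (j : PivotalStructure C)

theorem scalar_twist_iso {X Y : C} [Simple X] [Simple Y] (e : X ≅ Y) :
    scalar (j.twist X).hom = scalar (j.twist Y).hom :=
  scalar_iso_conj e _ _ (j.twist_naturality e.hom).symm

/-- An eigenvector has a nonzero component in `F` of some simple summand of `A`; by naturality the
twist acts on that component by the scalar of the summand. -/
theorem eigenvalue_twist (W A : C) (F : C ⥤ C) [F.Additive] [F.Linear ℂ] {μ : ℂ}
    (h : Module.End.HasEigenvalue (Linear.rightComp ℂ W (F.map (j.twist A).hom)) μ) :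
    ∃ z : SimpleClass C, μ = scalar (j.twist z.obj).hom := by
  obtain ⟨φ, hφ⟩ := h.exists_hasEigenvector
  have h₁ : φ ≫ F.map (j.twist A).hom = μ • φ := hφ.apply_eq_smul
  obtain ⟨n, S, hS, ⟨s⟩⟩ := exists_splitting A
  have h₂ : ∃ k, φ ≫ F.map (s.π k) ≠ 0 := by
    by_contra! h₀
    apply hφ.2
    rw [← Category.comp_id φ, ← (s.map F).total, Preadditive.comp_sum]
    refine Finset.sum_eq_zero fun k _ => ?_
    rw [← Category.assoc]
    exact (congrArg (· ≫ F.map (s.ι k)) (h₀ k)).trans zero_comp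
  obtain ⟨k, hk⟩ := h₂
  have := hS k
  refine ⟨SimpleClass.mk (S k), ?_⟩
  rw [j.scalar_twist_iso (SimpleClass.nonempty_iso_mk (S k)).some]
  apply smul_left_injective ℂ hk
  calc
    μ • φ ≫ F.map (s.π k) = φ ≫ F.map ((j.twist A).hom ≫ s.π k) := by
      rw [← Linear.smul_comp, ← h₁, F.map_comp, Category.assoc]
    _ = φ ≫ F.map (s.π k ≫ (scalar (j.twist (S k)).hom • 𝟙 (S k) : S k ⟶ S k)) := by
      rw [scalar_smul_id, j.twist_naturality]
    _ = _ := by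
      rw [Linear.comp_smul, Category.comp_id, F.map_smul, Linear.comp_smul]

/-- The relation between the twists of a threefold tensor product and of its subproducts. -/
theorem twist_tensor_tensor (X Y Z : C) [Simple X] [Simple Y] [Simple Z] :
    (scalar (j.twist X).hom * scalar (j.twist Y).hom * scalar (j.twist Z).hom) •
        (j.twist ((X ⊗ Y) ⊗ Z)).hom =
      (j.twist (X ⊗ Y)).hom ▷ Z ≫
        ((α_ X Y Z ≪≫ whiskerLeftIso X (β_ Y Z) ≪≫ (α_ X Z Y).symm).hom ≫
          (j.twist (X ⊗ Z)).hom ▷ Y ≫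
            (α_ X Y Z ≪≫ whiskerLeftIso X (β_ Y Z) ≪≫ (α_ X Z Y).symm).inv) ≫
        ((α_ X Y Z).hom ≫ X ◁ (j.twist (Y ⊗ Z)).hom ≫ (α_ X Y Z).inv) := by
  have h₁ : (X ⊗ Y) ◁ (j.twist Z).hom = scalar (j.twist Z).hom • 𝟙 _ := by
    conv_lhs => rw [← scalar_smul_id (j.twist Z).hom]
    rw [MonoidalLinear.whiskerLeft_smul, whiskerLeft_id]
  rw [j.twist_tensor (X ⊗ Y) Z, MonoidalCategory.tensorHom_def, h₁, doubleBraiding_tensor_left,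
    j.twist_tensor_simple X Z, j.twist_tensor_simple Y Z]
  simp only [MonoidalLinear.smul_whiskerRight, MonoidalLinear.whiskerLeft_smul, Linear.smul_comp,
    Linear.comp_smul, smul_smul, Category.assoc, Category.id_comp, Iso.trans_hom, Iso.trans_inv,
    Iso.symm_hom, Iso.symm_inv, whiskerLeftIso_hom, whiskerLeftIso_inv, Iso.inv_hom_id_assoc]
  congr 1
  · ring
  · congr 6
    rw [← whiskerLeft_comp_assoc, doubleBraiding, Iso.inv_hom_id_assoc]

/-- Take determinants of `twist_tensor_tensor` on `Hom(W, (X ⊗ Y) ⊗ Z)`, where by naturality the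
total twist acts as `θ_W`. -/
theorem prod_twist_pow (W X Y Z : C) [Simple W] [Simple X] [Simple Y] [Simple Z] :
    (scalar (j.twist X).hom * scalar (j.twist Y).hom * scalar (j.twist Z).hom *
        scalar (j.twist W).hom) ^ finrank ℂ (W ⟶ (X ⊗ Y) ⊗ Z) =
      LinearMap.det (Linear.rightComp ℂ W ((tensorRight Z).map (j.twist (X ⊗ Y)).hom)) *
      LinearMap.det (Linear.rightComp ℂ W ((tensorRight Y).map (j.twist (X ⊗ Z)).hom)) *
      LinearMap.det (Linear.rightComp ℂ W ((tensorLeft X).map (j.twist (Y ⊗ Z)).hom)) := by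
  have h₁ := congrArg (fun t => LinearMap.det (Linear.rightComp ℂ W t)) (j.twist_tensor_tensor X Y Z)
  rw [det_rightComp_comp, det_rightComp_comp, det_rightComp_conj, det_rightComp_conj,
    ← mul_assoc] at h₁
  refine Eq.trans ?_ h₁
  rw [← mul_one (_ ^ _), ← LinearMap.det_id (A := ℂ) (M := (W ⟶ (X ⊗ Y) ⊗ Z)), ← LinearMap.det_smul]
  congr 1
  ext f
  rw [Linear.rightComp_apply, Linear.comp_smul, j.twist_naturality, ← scalar_smul_id (j.twist W).hom,
    Linear.smul_comp, Category.id_comp, smul_smul, scalar_smul_id]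
  rfl

end PivotalStructure

namespace SphericalStructure

variable (j : SphericalStructure C)

theorem θ_dual (X : C) [Simple X] : j.θ (dual X) = j.θ X := by
  have h : j.twistTrace (dual X) = j.twistTrace X := by
    rw [PivotalStructure.twistTrace, PivotalStructure.twistTrace, PivotalStructure.trace_eq,
      PivotalStructure.trace_eq, PivotalStructure.pcoev_twist_ev_dual]
  rw [PivotalStructure.twistTrace_eq, PivotalStructure.twistTrace_eq, ← j.spherical X] at h
  exact mul_right_cancel₀ (j.dim_ne_zero X) h

theorem θ_pow_four (X : C) [Simple X] :
    (j.θ X ^ 4) ^ finrank ℂ (X ⟶ (X ⊗ dual X) ⊗ X) =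
      LinearMap.det (Linear.rightComp ℂ X ((tensorRight X).map (j.twist (X ⊗ dual X)).hom)) *
      LinearMap.det (Linear.rightComp ℂ X ((tensorRight (dual X)).map (j.twist (X ⊗ X)).hom)) *
      LinearMap.det (Linear.rightComp ℂ X ((tensorLeft X).map (j.twist (dual X ⊗ X)).hom)) := by
  rw [← j.prod_twist_pow X X (dual X) X]
  have h : scalar (j.twist (dual X)).hom = j.θ X := j.θ_dual X
  rw [h, θ]
  congr 1
  ring

/-- In `θ_pow_four`, four factors `θ_X` face three determinants, each a product of `n` twists of
simple objects. If `M` is the largest modulus of a twist, attained at the chosen class, then `M^(4n)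
≤ M^(3n)`, so `M ≤ 1` as `n > 0`. The smallest modulus satisfies the reverse inequality. -/
theorem norm_θ (X : C) [Simple X] : ‖j.θ X‖ = 1 := by
  have hne : Nonempty (SimpleClass C) := ⟨SimpleClass.mk X⟩
  have hθ₀ : ∀ (Y : C) [Simple Y], 0 < ‖j.θ Y‖ := fun Y _ => norm_pos_iff.mpr (scalar_ne_zero _)
  have hiso : j.θ X = j.θ (SimpleClass.mk X).obj :=
    (j.scalar_twist_iso (SimpleClass.nonempty_iso_mk X).some).symm
  apply le_antisymm
  · obtain ⟨z, hz⟩ := Finite.exists_max (fun z : SimpleClass C => ‖j.θ z.obj‖)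
    rw [hiso]
    refine (hz _).trans ?_
    set n := finrank ℂ (z.obj ⟶ (z.obj ⊗ dual z.obj) ⊗ z.obj) with hn
    set M := ‖j.θ z.obj‖ with hM
    have hdet : ∀ (A : C) (F : C ⥤ C) [F.Additive] [F.Linear ℂ],
        finrank ℂ (z.obj ⟶ F.obj A) = n →
          ‖LinearMap.det (Linear.rightComp ℂ z.obj (F.map (j.twist A).hom))‖ ≤ M ^ n := by
      rintro A F _ _ hA
      rw [← hA]
      refine norm_det_le _ fun μ hμ => ?_
      obtain ⟨w, rfl⟩ := j.eigenvalue_twist _ _ _ hμ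
      exact hz w
    have h := congrArg norm (j.θ_pow_four z.obj)
    rw [norm_mul, norm_mul, norm_pow, norm_pow, ← hM, ← hn] at h
    have h₁ := hdet (z.obj ⊗ dual z.obj) (tensorRight z.obj) rfl
    have h₂ := hdet (z.obj ⊗ z.obj) (tensorRight (dual z.obj)) (finrank_hom_tensor_dual_tensor_eq z.obj).1
    have h₃ := hdet (dual z.obj ⊗ z.obj) (tensorLeft z.obj) (finrank_hom_tensor_dual_tensor_eq z.obj).2
    have h₄ : (M ^ 4) ^ n ≤ M ^ n * M ^ n * M ^ n := by
      rw [h]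
      gcongr
    have hp : 0 < M ^ n := pow_pos (hθ₀ _) n
    have h₅ : M ^ n ≤ 1 := by
      have : M ^ n * (M ^ n * M ^ n * M ^ n) ≤ 1 * (M ^ n * M ^ n * M ^ n) := by
        calc
          _ = (M ^ 4) ^ n := by ring
          _ ≤ _ := by rw [one_mul]; exact h₄
      exact le_of_mul_le_mul_right this (by positivity)
    exact (pow_le_one_iff_of_nonneg (hθ₀ _).le (finrank_hom_tensor_dual_tensor_pos _).ne').mp h₅
  · obtain ⟨z, hz⟩ := Finite.exists_min (fun z : SimpleClass C => ‖j.θ z.obj‖)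
    rw [hiso]
    refine le_trans ?_ (hz _)
    set n := finrank ℂ (z.obj ⟶ (z.obj ⊗ dual z.obj) ⊗ z.obj) with hn
    set M := ‖j.θ z.obj‖ with hM
    have hdet : ∀ (A : C) (F : C ⥤ C) [F.Additive] [F.Linear ℂ],
        finrank ℂ (z.obj ⟶ F.obj A) = n →
          M ^ n ≤ ‖LinearMap.det (Linear.rightComp ℂ z.obj (F.map (j.twist A).hom))‖ := by
      rintro A F _ _ hA
      rw [← hA]
      refine le_norm_det _ (norm_nonneg _) fun μ hμ => ?_
      obtain ⟨w, rfl⟩ := j.eigenvalue_twist _ _ _ hμ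
      exact hz w
    have h := congrArg norm (j.θ_pow_four z.obj)
    rw [norm_mul, norm_mul, norm_pow, norm_pow, ← hM, ← hn] at h
    have h₁ := hdet (z.obj ⊗ dual z.obj) (tensorRight z.obj) rfl
    have h₂ := hdet (z.obj ⊗ z.obj) (tensorRight (dual z.obj)) (finrank_hom_tensor_dual_tensor_eq z.obj).1
    have h₃ := hdet (dual z.obj ⊗ z.obj) (tensorLeft z.obj) (finrank_hom_tensor_dual_tensor_eq z.obj).2
    have hp : 0 < M ^ n := pow_pos (hθ₀ _) n
    have h₄ : M ^ n * M ^ n * M ^ n ≤ (M ^ 4) ^ n := by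
      rw [h]
      gcongr
    have h₅ : 1 ≤ M ^ n := by
      have : 1 * (M ^ n * M ^ n * M ^ n) ≤ M ^ n * (M ^ n * M ^ n * M ^ n) := by
        calc
          _ ≤ (M ^ 4) ^ n := by rw [one_mul]; exact h₄
          _ = _ := by ring
      exact le_of_mul_le_mul_right this (by positivity)
    exact (one_le_pow_iff_of_nonneg (hθ₀ _).le (finrank_hom_tensor_dual_tensor_pos _).ne').mp h₅

end SphericalStructure

end Fusion

/-! ### The `S`-matrix and Gauss sums -/

section Fusion

variable {C : Type u} [Category.{v} C] [Abelian C] [Linear ℂ C] [MonoidalCategory C]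
  [MonoidalPreadditive C] [MonoidalLinear ℂ C] [RigidCategory C] [IsFusion C]

/-- The permutation of the isomorphism classes of simple objects given by duality, using that
`X** ≅ X` in a pivotal category. -/
def SimpleClass.dualEquiv (j : PivotalStructure C) : SimpleClass C ≃ SimpleClass C :=
  Function.Involutive.toPerm (fun x => SimpleClass.mk (dual x.obj)) fun x =>
    (SimpleClass.mk_eq_mk (dualIso (SimpleClass.nonempty_iso_mk (dual x.obj)).some ≪≫
      (j.appIso x.obj).symm)).trans x.mk_obj

namespace SphericalStructure

variable (j : SphericalStructure C)

theorem dim_dualEquiv (x : SimpleClass C) :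
    j.dim (SimpleClass.dualEquiv j.toPivotalStructure x).obj = j.dim x.obj := by
  rw [j.spherical x.obj]
  exact j.isAdditive_dim.iso (SimpleClass.nonempty_iso_mk (dual x.obj)).some

variable [BraidedCategory C]

theorem encircleScalar_dual (X Y : C) [Simple Y] :
    j.encircleScalar (dual X) Y = starRingEnd ℂ (j.encircleScalar X Y) :=
  character_dual (j.isAdditive_encircleScalar Y) (fun X X' => j.encircleScalar_tensor X X' Y) X

theorem dim_dual (X : C) : j.dim (dual X) = starRingEnd ℂ (j.dim X) := by
  rw [← j.encircleScalar_unit, ← j.encircleScalar_unit, encircleScalar_dual]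

/-- Conjugation passes to the dual because `dim` is a character; sphericality returns to `X`. -/
theorem conj_dim (X : C) [Simple X] : starRingEnd ℂ (j.dim X) = j.dim X := by
  rw [← dim_dual, ← j.spherical]

theorem conj_θ (X : C) [Simple X] : starRingEnd ℂ (j.θ X) = (j.θ X)⁻¹ := by
  rw [Complex.inv_def, Complex.normSq_eq_norm_sq, j.norm_θ]
  simp

theorem θ_ne_zero (X : C) [Simple X] : j.θ X ≠ 0 := scalar_ne_zero _

theorem conj_gaussSum (n : ℤ) : starRingEnd ℂ (j.gaussSum n) = j.gaussSum (-n) := by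
  simp only [gaussSum, map_sum, map_mul, map_zpow₀, map_pow, conj_dim, conj_θ, inv_zpow', zpow_neg]

/-- The entry of the `S`-matrix at two isomorphism classes of simple objects. -/
def sMatrix (x y : SimpleClass C) : ℂ := j.encircleScalar x.obj y.obj * j.dim y.obj

/-- The trace of the twist on `x ⊗ y`, computed by decomposition into simple objects and by
balancing. -/
theorem sum_fusion_mul (x y : SimpleClass C) :
    ∑ z : SimpleClass C, (finrank ℂ (x.obj ⊗ y.obj ⟶ z.obj) : ℂ) * (j.θ z.obj * j.dim z.obj) =
      j.θ x.obj * j.θ y.obj * j.sMatrix x y := by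
  rw [sMatrix, θ, θ, ← j.twistTrace_tensor, j.isAdditive_twistTrace.eq_sum]
  refine Finset.sum_congr rfl fun z _ => ?_
  rw [j.twistTrace_eq, θ]

/-- The braiding makes the fusion coefficients symmetric in `x` and `y`, and the twists in
`sum_fusion_mul` are invertible. -/
theorem sMatrix_comm (x y : SimpleClass C) : j.sMatrix x y = j.sMatrix y x := by
  have h₁ := j.sum_fusion_mul x y
  have h₂ := j.sum_fusion_mul y x
  have h₃ : ∀ z : SimpleClass C,
      finrank ℂ (x.obj ⊗ y.obj ⟶ z.obj) = finrank ℂ (y.obj ⊗ x.obj ⟶ z.obj) := fun z =>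
    (Linear.homCongr ℂ (β_ x.obj y.obj) (Iso.refl z.obj)).finrank_eq
  simp only [h₃] at h₁
  rw [h₁, mul_comm (j.θ y.obj)] at h₂
  exact mul_left_cancel₀ (mul_ne_zero (j.θ_ne_zero _) (j.θ_ne_zero _)) h₂

theorem sMatrix_dual (x y : SimpleClass C) :
    j.sMatrix (SimpleClass.dualEquiv j.toPivotalStructure x) y = starRingEnd ℂ (j.sMatrix x y) := by
  rw [sMatrix, sMatrix, map_mul, conj_dim, ← encircleScalar_dual]
  congr 1
  exact (j.isAdditive_encircleScalar y.obj).iso (SimpleClass.nonempty_iso_mk (dual x.obj)).some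

theorem θ_dualEquiv (x : SimpleClass C) :
    j.θ (SimpleClass.dualEquiv j.toPivotalStructure x).obj = j.θ x.obj := by
  rw [← j.θ_dual x.obj]
  exact j.scalar_twist_iso (SimpleClass.nonempty_iso_mk (dual x.obj)).some

/-- Since `N_{xy}^z` is the multiplicity of `x` in `y* ⊗ z`, the sum is the dimension of `y* ⊗ z`.
-/
theorem sum_dim_mul_fusion (y z : SimpleClass C) :
    ∑ x : SimpleClass C, (finrank ℂ (x.obj ⊗ y.obj ⟶ z.obj) : ℂ) * j.dim x.obj =
      j.dim y.obj * j.dim z.obj := by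
  rw [j.spherical y.obj, ← j.dim_tensor, j.isAdditive_dim.eq_sum]
  refine Finset.sum_congr rfl fun x _ => ?_
  rw [← finrank_tensor_hom,
    (Linear.homCongr ℂ (β_ x.obj y.obj) (Iso.refl z.obj)).finrank_eq]

theorem gaussSum_one_mul_gaussSum_neg_two :
    j.gaussSum 1 * j.gaussSum (-2) =
      ∑ x : SimpleClass C, ∑ y : SimpleClass C,
        j.θ x.obj * (j.θ y.obj)⁻¹ * j.dim x.obj * j.dim y.obj * j.sMatrix x y := by
  have h : ∀ x y : SimpleClass C,
      j.θ x.obj * (j.θ y.obj)⁻¹ * j.dim x.obj * j.dim y.obj * j.sMatrix x y =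
        ∑ z : SimpleClass C, j.θ z.obj * j.dim z.obj * (j.θ y.obj ^ (-2 : ℤ) * j.dim y.obj) *
          ((finrank ℂ (x.obj ⊗ y.obj ⟶ z.obj) : ℂ) * j.dim x.obj) := by
    intro x y
    have hy := j.θ_ne_zero y.obj
    calc
      -- Splitting `θ_y⁻¹ = θ_y⁻² θ_y` completes the factor `θ_x θ_y S_{xy}` of the balancing
      -- equation and leaves the exponent of `τ_{-2}`.
      _ = j.θ y.obj ^ (-2 : ℤ) * j.dim y.obj * j.dim x.obj *
            (j.θ x.obj * j.θ y.obj * j.sMatrix x y) := by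
        rw [zpow_neg]
        field_simp
      _ = _ := by
        rw [← sum_fusion_mul, Finset.mul_sum]
        exact Finset.sum_congr rfl fun z _ => by ring
  simp only [h]
  rw [Finset.sum_comm]
  simp_rw [fun y : SimpleClass C => Finset.sum_comm (s := Finset.univ) (t := Finset.univ)
    (f := fun x z : SimpleClass C => j.θ z.obj * j.dim z.obj *
      (j.θ y.obj ^ (-2 : ℤ) * j.dim y.obj) *
        ((finrank ℂ (x.obj ⊗ y.obj ⟶ z.obj) : ℂ) * j.dim x.obj)), ← Finset.mul_sum,
    sum_dim_mul_fusion]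
  rw [gaussSum, gaussSum, Finset.sum_mul_sum, Finset.sum_comm]
  refine Finset.sum_congr rfl fun y _ => Finset.sum_congr rfl fun z _ => ?_
  rw [zpow_one]
  ring

theorem conj_gaussSum_one_mul_gaussSum_neg_two :
    starRingEnd ℂ (j.gaussSum 1 * j.gaussSum (-2)) = j.gaussSum 1 * j.gaussSum (-2) := by
  rw [gaussSum_one_mul_gaussSum_neg_two]
  set e := SimpleClass.dualEquiv j.toPivotalStructure
  calc
    _ = ∑ x : SimpleClass C, ∑ y : SimpleClass C, (j.θ (e x).obj)⁻¹ * j.θ y.obj *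
          j.dim (e x).obj * j.dim y.obj * j.sMatrix (e x) y := by
      simp only [map_sum, map_mul, map_inv₀, conj_dim, conj_θ, inv_inv, ← sMatrix_dual,
        θ_dualEquiv, dim_dualEquiv, e]
    _ = ∑ x : SimpleClass C, ∑ y : SimpleClass C, (j.θ x.obj)⁻¹ * j.θ y.obj *
          j.dim x.obj * j.dim y.obj * j.sMatrix x y :=
      e.sum_comp fun x => ∑ y : SimpleClass C, (j.θ x.obj)⁻¹ * j.θ y.obj *
          j.dim x.obj * j.dim y.obj * j.sMatrix x y
    _ = _ := by
      rw [Finset.sum_comm]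
      refine Finset.sum_congr rfl fun x _ => Finset.sum_congr rfl fun y _ => ?_
      rw [sMatrix_comm]
      ring

end SphericalStructure

end Fusion

end Premodular

end

theorem proposition3p12 {C : Type u} [Category.{v} C] [Abelian C] [Linear ℂ C]
    [MonoidalCategory C] [MonoidalPreadditive C] [MonoidalLinear ℂ C] [RigidCategory C]
    [Premodular.IsFusion C] [BraidedCategory C] (j : Premodular.SphericalStructure C) :
    (∃ r : ℝ, j.gaussSum 1 * j.gaussSum (-2) = (r : ℂ)) ∧
    j.gaussSum 1 * j.gaussSum (-2) = j.gaussSum (-1) * j.gaussSum 2 ∧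
    (j.gaussSum 1 * j.gaussSum (-2) ≠ 0 →
      (j.gaussSum 1 ≠ 0 ∧ j.gaussSum (-1) ≠ 0 ∧ j.gaussSum 2 ≠ 0 ∧ j.gaussSum (-2) ≠ 0) ∧
      j.anomaly 1 = j.anomaly 2 ∧
      (j.centralCharge 1 = j.centralCharge 2 ∨ j.centralCharge 1 = -j.centralCharge 2)) := by
  set a := j.gaussSum 1
  set b := j.gaussSum 2
  have ha : j.gaussSum (-1) = starRingEnd ℂ a := (j.conj_gaussSum 1).symm
  have hb : j.gaussSum (-2) = starRingEnd ℂ b := (j.conj_gaussSum 2).symm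
  have hconj : starRingEnd ℂ (a * j.gaussSum (-2)) = a * j.gaussSum (-2) :=
    j.conj_gaussSum_one_mul_gaussSum_neg_two
  obtain ⟨r, hr⟩ := Complex.conj_eq_iff_real.mp hconj
  -- The right side is the conjugate of the left, which is real.
  have hcomm : a * j.gaussSum (-2) = j.gaussSum (-1) * b := by
    rw [← hconj, map_mul, hb, Complex.conj_conj, ha]
  refine ⟨⟨r, hr⟩, hcomm, fun h => ?_⟩
  have ha₀ : a ≠ 0 := left_ne_zero_of_mul h
  have hb₀' : j.gaussSum (-2) ≠ 0 := right_ne_zero_of_mul h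
  rw [hcomm] at h
  have ha₀' : j.gaussSum (-1) ≠ 0 := left_ne_zero_of_mul h
  have hb₀ : b ≠ 0 := right_ne_zero_of_mul h
  refine ⟨⟨ha₀, ha₀', hb₀, hb₀'⟩, ?_, ?_⟩
  · rw [Premodular.SphericalStructure.anomaly, Premodular.SphericalStructure.anomaly,
      div_eq_div_iff ha₀' hb₀', hcomm, mul_comm]
  -- Because `|τ_n|² = τ_n τ_{-n}`, the square of `ξ_n` is `α_n`; equal anomalies thus determine `ξ`
  -- up to sign.
  · apply sq_eq_sq_iff_eq_or_eq_neg.mp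
    rw [Premodular.SphericalStructure.centralCharge, Premodular.SphericalStructure.centralCharge,
      div_pow, div_pow, ← Complex.mul_conj', ← Complex.mul_conj', ← ha, ← hb,
      div_eq_div_iff (mul_ne_zero ha₀ ha₀') (mul_ne_zero hb₀ hb₀')]
    linear_combination a * b * hcomm
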